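/- A \emph{hoop} is an algebra $(A,\otimes,\to,1)$ such that $(A,\otimes,1)$ is a commutative monoid and, for all $x,y,z\in A$, $x\to x=1$, $x\otimes(x\to y)=y\otimes(y\to x)$ and $x\to(y\to z)=(x\otimes y)\to z$; it is ordered by $x\le y$ iff $x\to y=1$, and $x\wedge y=x\otimes(x\to y)$. A \emph{BL-algebra} is a hoop $(L,\otimes,\to,0,1)$ with a minimum $0$ such that $(x\to y)\to z\le((y\to x)\to z)\to z$ for all $x,y,z\in L$; it is a lattice. In a BL-algebra put $\bar x=x\to 0$ and $x+y=(\bar x\to y)\wedge(\bar y\to x)$; this operation is commutative and associative. A \emph{good sequence} of a BL-algebra $L$ is a sequence $\mathbf a=(a_1,a_2,\dots)$ in $L$ with $a_i+a_{i+1}=a_i$ for all $i\ge 1$ and $a_i=0$ for all sufficiently large $i$; for $x\in L$ write $(x)=(x,0,0,\dots)$. The set $M_L$ of good sequences carries the termwise order, for which it is a lattice with termwise operations, and the addition $\mathbf a+\mathbf b=\mathbf c$ with $$c_i=a_i+(a_{i-1}\otimes b_1)+\cdots+(a_1\otimes b_{i-1})+b_i .$$ On $M_L\times M_L$ let $(\mathbf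 a,\mathbf b)\sim(\mathbf c,\mathbf d)$ iff $(\mathbf a+\mathbf d)+\mathbf k=(\mathbf b+\mathbf c)+\mathbf k$ for some $\mathbf k\in M_L$. This is an equivalence relation. Let $[\mathbf a,\mathbf b]$ denote the class of $(\mathbf a,\mathbf b)$ and let $G_L=(M_L\times M_L)/{\sim}$. With the well-defined operations $[\mathbf a,\mathbf b]+[\mathbf c,\mathbf d]=[\mathbf a+\mathbf c,\mathbf b+\mathbf d]$, $0=[(0),(0)]$, $-[\mathbf a,\mathbf b]=[\mathbf b,\mathbf a]$, and the order $[\mathbf a,\mathbf b]\preceq[\mathbf c,\mathbf d]$ iff $(\mathbf a+\mathbf d)+\mathbf k\le(\mathbf b+\mathbf c)+\mathbf k$ for some $\mathbf k\in M_L$, $G_L$ is an abelian lattice-ordered group (the Chang $\ell$-group of $L$), in which $[\mathbf a,\mathbf b]\vee[\mathbf c,\mathbf d]=[(\mathbf a+\mathbf d)\vee(\mathbf b+\mathbf c),\mathbf b+\mathbf d]$ and $[\mathbf a,\mathbf b]\wedge[\mathbf c,\mathbf d]=[(\mathbf a+\mathbf d)\wedge(\mathbf b+\mathbf c),\mathbf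 b+\mathbf d]$. \textbf{Proposition.} For every BL-algebra $L$, the element $u_L=[(1),(0)]$ is a strong unit of the $\ell$-group $G_L$; that is, $0\preceq u_L$, and for every $x\in G_L$ there is an integer $n\ge 1$ with $x\preceq n\,u_L$. -/

import Mathlib

universe u

/-- A hoop `(A, ⊗, →, 1)`; the product `⊗` is written `*` and the residuum `→` is written `⇨`. -/
class Hoop (A : Type u) extends CommMonoid A, HImp A where
  imp_refl : ∀ x : A, x ⇨ x = 1
  mul_imp_comm : ∀ x y : A, x * (x ⇨ y) = y * (y ⇨ x)
  imp_imp : ∀ x y z : A, x ⇨ (y ⇨ z) = (x * y) ⇨ z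

namespace Hoop

variable {A : Type u} [Hoop A]

theorem imp_antisymm {x y : A} (h : x ⇨ y = 1) (h2 : y ⇨ x = 1) : x = y := by
  have := mul_imp_comm x y
  rwa [h, h2, mul_one, mul_one] at this

theorem one_imp (x : A) : 1 ⇨ x = x := by
  apply imp_antisymm
  · have h := imp_refl (1 ⇨ x)
    rwa [imp_imp (1 ⇨ x) 1 x, mul_one] at h
  · rw [imp_imp, mul_one, imp_refl]

theorem imp_one (x : A) : x ⇨ 1 = 1 := by
  have h : (x ⇨ 1) * x = x := by
    rw [mul_comm, mul_imp_comm, one_mul, one_imp]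
  have := imp_refl (x ⇨ 1)
  rwa [imp_imp, h] at this

/-- The natural order of a hoop: `x ≤ y` iff `x → y = 1`. -/
instance (priority := 50) : PartialOrder A where
  le x y := x ⇨ y = 1
  le_refl := imp_refl
  le_trans x y z h h2 := by
    have e : x = (y ⇨ x) * y := by
      rw [mul_comm, ← mul_imp_comm, h, mul_one]
    rw [e, ← imp_imp, h2, imp_one]
  le_antisymm x y h h2 := imp_antisymm h h2

theorem le_def {x y : A} : x ≤ y ↔ x ⇨ y = 1 := Iff.rfl

theorem le_imp {x y z : A} : x ≤ y ⇨ z ↔ x * y ≤ z := by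
  rw [le_def, le_def, imp_imp]

theorem le_one (x : A) : x ≤ 1 := imp_one x

theorem one_le_iff {x : A} : 1 ≤ x ↔ x = 1 := by rw [le_def, one_imp]

theorem imp_mul_le (x y : A) : (x ⇨ y) * x ≤ y := le_imp.1 le_rfl

theorem mul_mono_left {x y : A} (h : x ≤ y) (z : A) : x * z ≤ y * z :=
  le_imp.1 (h.trans (le_imp.2 le_rfl))

instance : IsOrderedMonoid A where
  mul_le_mul_left _ _ h z := mul_mono_left h z

theorem mul_le_left (x y : A) : x * y ≤ x := by
  simpa using mul_le_mul_right (le_one y) x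

theorem mul_le_right (x y : A) : x * y ≤ y := by
  rw [mul_comm]; exact mul_le_left y x

theorem le_imp_self (x y : A) : x ≤ y ⇨ x := le_imp.2 (mul_le_left x y)

theorem imp_mono {x x2 y y2 : A} (h : x2 ≤ x) (h2 : y ≤ y2) : x ⇨ y ≤ x2 ⇨ y2 :=
  le_imp.2 ((mul_le_mul_right h _).trans ((imp_mul_le x y).trans h2))

theorem imp_left_comm (x y z : A) : x ⇨ (y ⇨ z) = y ⇨ (x ⇨ z) := by
  rw [imp_imp, imp_imp, mul_comm]

theorem le_imp_imp (x y : A) : x ≤ (x ⇨ y) ⇨ y := by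
  rw [le_imp, mul_comm]; exact imp_mul_le x y

theorem imp_trans (x y z : A) : (x ⇨ y) * (y ⇨ z) ≤ x ⇨ z := by
  rw [le_imp, mul_right_comm]
  exact (mul_le_mul_left (imp_mul_le x y) _).trans (by rw [mul_comm]; exact imp_mul_le y z)

/-- In a hoop, `x ∧ y = x ⊗ (x → y)`. -/
instance (priority := 50) : SemilatticeInf A where
  inf x y := x * (x ⇨ y)
  inf_le_left x y := mul_le_left _ _
  inf_le_right x y := by rw [mul_comm]; exact imp_mul_le x y
  le_inf x y z h h2 := by
    have e : x = y * (y ⇨ x) := by rw [← mul_imp_comm, le_def.1 h, mul_one]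
    calc x = y * (y ⇨ x) := e
      _ ≤ y * (y ⇨ z) := mul_le_mul_right (imp_mono le_rfl h2) _

theorem inf_def (x y : A) : x ⊓ y = x * (x ⇨ y) := rfl

theorem mul_imp_of_le {x y : A} (h : y ≤ x) : x * (x ⇨ y) = y := by
  rw [← inf_def, inf_eq_right.2 h]

end Hoop

/-- A BL-algebra: a bounded hoop (a hoop with a minimum `0`) that satisfies
`(x → y) → z ≤ ((y → x) → z) → z`. -/
class BLAlgebra (L : Type u) extends Hoop L, Zero L where
  zero_le : ∀ x : L, (0 : L) ≤ x
  prelinear : ∀ x y z : L, (x ⇨ y) ⇨ z ≤ ((y ⇨ x) ⇨ z) ⇨ z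

namespace BLAlgebra

open Hoop

variable {L : Type u} [BLAlgebra L]

theorem eq_one_of_imp_le {x y z : L} (h : x ⇨ y ≤ z) (h2 : y ⇨ x ≤ z) : z = 1 := by
  have := prelinear x y z
  rwa [le_def.1 h, le_def.1 h2, one_imp, one_le_iff] at this

/-- The lattice structure of a BL-algebra. The order and the meet are those of the hoop, and
`x ∨ y = ((x → y) → y) ∧ ((y → x) → x)`. -/
instance (priority := 50) : Lattice L where
  inf x y := x ⊓ y
  sup x y := ((x ⇨ y) ⇨ y) ⊓ ((y ⇨ x) ⇨ x)
  le_sup_left x y := le_inf (le_imp_imp x y) (le_imp_self _ _)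
  le_sup_right x y := le_inf (le_imp_self _ _) (le_imp_imp y x)
  sup_le x y z h h2 := by
    apply eq_one_of_imp_le (x := x) (y := y)
    · rw [le_imp, mul_comm, ← le_imp]
      exact inf_le_left.trans (imp_mono le_rfl h2)
    · rw [le_imp, mul_comm, ← le_imp]
      exact inf_le_right.trans (imp_mono le_rfl h)
  inf_le_left _ _ := inf_le_left
  inf_le_right _ _ := inf_le_right
  le_inf _ _ _ := le_inf

theorem sup_def (x y : L) : x ⊔ y = ((x ⇨ y) ⇨ y) ⊓ ((y ⇨ x) ⇨ x) := rfl

theorem imp_sup_imp (x y : L) : (x ⇨ y) ⊔ (y ⇨ x) = 1 :=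
  eq_one_of_imp_le le_sup_left le_sup_right

theorem le_zero {x : L} : x ≤ 0 ↔ x = 0 :=
  ⟨fun h => le_antisymm h (zero_le x), fun h => h.le⟩

theorem zero_mul' (x : L) : 0 * x = 0 := le_zero.1 (mul_le_left 0 x)

theorem mul_zero' (x : L) : x * 0 = 0 := le_zero.1 (mul_le_right x 0)

theorem zero_imp (x : L) : 0 ⇨ x = 1 := zero_le x

/-- The complement `x → 0`. -/
def neg (x : L) : L := x ⇨ 0

/-- The addition `x + y = (x̄ → y) ∧ (ȳ → x)` of a BL-algebra. -/
instance (priority := 50) : Add L where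
  add x y := (neg x ⇨ y) ⊓ (neg y ⇨ x)

theorem add_def (x y : L) : x + y = (neg x ⇨ y) ⊓ (neg y ⇨ x) := rfl

theorem neg_anti {x y : L} (h : x ≤ y) : neg y ≤ neg x := imp_mono h le_rfl

theorem add_mono {x y z t : L} (h : x ≤ y) (h2 : z ≤ t) : x + z ≤ y + t :=
  inf_le_inf (imp_mono (neg_anti h) h2) (imp_mono (neg_anti h2) h)

theorem blAdd_comm (x y : L) : x + y = y + x := inf_comm _ _

theorem neg_zero' : neg (0 : L) = 1 := imp_refl (0 : L)

theorem neg_one' : neg (1 : L) = 0 := one_imp (0 : L)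

theorem zero_add' (x : L) : 0 + x = x := by
  rw [add_def, neg_zero', one_imp, inf_eq_left]
  exact le_imp_imp x 0

theorem add_zero' (x : L) : x + 0 = x := by rw [blAdd_comm, zero_add']

theorem one_add' (x : L) : 1 + x = 1 := by
  rw [add_def, neg_one', zero_imp, imp_one, inf_idem]

theorem add_one' (x : L) : x + 1 = 1 := by rw [blAdd_comm, one_add']

theorem le_add_left' (x y : L) : x ≤ x + y := by
  have h := add_mono (le_refl x) (zero_le y)
  rwa [add_zero'] at h

theorem le_neg_neg (x : L) : x ≤ neg (neg x) := le_imp_imp x 0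

theorem neg_neg_neg (x : L) : neg (neg (neg x)) = neg x :=
  le_antisymm (neg_anti (le_neg_neg x)) (le_neg_neg _)

theorem le_neg_iff {x y : L} : x ≤ neg y ↔ x * y = 0 := by rw [neg, le_imp, le_zero]

theorem neg_eq_one {x : L} : neg x = 1 ↔ x = 0 := by
  rw [← one_le_iff, le_neg_iff, one_mul]

theorem neg_mul (x y : L) : neg (x * y) = x ⇨ neg y := (imp_imp x y 0).symm

theorem imp_neg_comm (x y : L) : x ⇨ neg y = y ⇨ neg x := imp_left_comm x y 0

/-! ### Representation by chains -/

/-- A homomorphism of BL-algebras. -/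
structure Hom (L C : Type u) [BLAlgebra L] [BLAlgebra C] where
  toFun : L → C
  map_zero : toFun 0 = 0
  map_one : toFun 1 = 1
  map_mul : ∀ x y, toFun (x * y) = toFun x * toFun y
  map_imp : ∀ x y, toFun (x ⇨ y) = toFun x ⇨ toFun y

namespace Hom

variable {C : Type u} [BLAlgebra C] (f : Hom L C)

theorem map_inf (x y : L) : f.toFun (x ⊓ y) = f.toFun x ⊓ f.toFun y := by
  simp only [inf_def, f.map_mul, f.map_imp]

theorem map_sup (x y : L) : f.toFun (x ⊔ y) = f.toFun x ⊔ f.toFun y := by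
  simp only [sup_def, f.map_inf, f.map_imp]

theorem map_add (x y : L) : f.toFun (x + y) = f.toFun x + f.toFun y := by
  simp only [add_def, neg, f.map_inf, f.map_imp, f.map_zero]

end Hom

/-- An implicative filter of a BL-algebra. -/
structure IsFilter (F : Set L) : Prop where
  one_mem : 1 ∈ F
  mul_mem : ∀ x ∈ F, ∀ y ∈ F, x * y ∈ F
  up : ∀ x ∈ F, ∀ y, x ≤ y → y ∈ F

theorem sup_mul_sup_le (s t c : L) : (s ⊔ c) * (t ⊔ c) ≤ s * t ⊔ c := by
  rw [← le_imp]
  refine sup_le ?_ ((mul_le_left _ _).trans le_sup_right |> le_imp.2)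
  rw [le_imp, mul_comm, ← le_imp]
  refine sup_le ?_ ((mul_le_left _ _).trans le_sup_right |> le_imp.2)
  rw [le_imp, mul_comm]
  exact le_sup_left

theorem IsFilter.residual {F : Set L} (hF : IsFilter F) (c : L) :
    IsFilter {s | s ⊔ c ∈ F} where
  one_mem := hF.up 1 hF.one_mem _ le_sup_left
  mul_mem _ hx _ hy := hF.up _ (hF.mul_mem _ hx _ hy) _ (sup_mul_sup_le _ _ c)
  up _ hx _ h := hF.up _ hx _ (sup_le_sup_right h c)

theorem exists_prime {t : L} (ht : t ≠ 1) :
    ∃ F : Set L, IsFilter F ∧ t ∉ F ∧ ∀ x y : L, x ⇨ y ∈ F ∨ y ⇨ x ∈ F := by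
  obtain ⟨F, -, ⟨hF, htF⟩, hmax⟩ := zorn_subset_nonempty {F : Set L | IsFilter F ∧ t ∉ F}
    (by
      intro c hc hchain hne
      refine ⟨⋃₀ c, ⟨⟨?_, ?_, ?_⟩, ?_⟩, fun s hs => Set.subset_sUnion_of_mem hs⟩
      · obtain ⟨s, hs⟩ := hne
        exact ⟨s, hs, (hc hs).1.one_mem⟩
      · rintro x ⟨s, hs, hx⟩ y ⟨s2, hs2, hy⟩
        rcases hchain.total hs hs2 with h | h
        · exact ⟨s2, hs2, (hc hs2).1.mul_mem _ (h hx) _ hy⟩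
        · exact ⟨s, hs, (hc hs).1.mul_mem _ hx _ (h hy)⟩
      · rintro x ⟨s, hs, hx⟩ y h
        exact ⟨s, hs, (hc hs).1.up _ hx _ h⟩
      · rintro ⟨s, hs, hx⟩
        exact (hc hs).2 hx)
    {1} ⟨⟨rfl, by rintro x rfl y rfl; exact mul_one 1, by
      rintro x rfl y h; exact one_le_iff.1 h⟩, ht⟩
  refine ⟨F, hF, htF, fun x y => ?_⟩
  have key : ∀ c : L, t ⊔ c ∉ F → ∀ s, s ⊔ c ∈ F → s ∈ F := fun c h s hs =>
    hmax (y := {s | s ⊔ c ∈ F}) ⟨hF.residual c, h⟩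
      (fun z hz => hF.up _ hz _ le_sup_left) hs
  have h1 : (x ⇨ y) ⊔ (y ⇨ x) ∈ F := by rw [imp_sup_imp]; exact hF.one_mem
  by_cases h : t ⊔ (y ⇨ x) ∈ F
  · right
    exact key t (by rwa [sup_idem]) _ (by rwa [sup_comm])
  · exact Or.inl (key _ h _ h1)

/-- The congruence of a filter. -/
def filterSetoid (F : Set L) (hF : IsFilter F) : Setoid L where
  r x y := x ⇨ y ∈ F ∧ y ⇨ x ∈ F
  iseqv :=
    { refl := fun x => by simp only [imp_refl, hF.one_mem, and_self]
      symm := fun h => ⟨h.2, h.1⟩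
      trans := fun h h2 => ⟨hF.up _ (hF.mul_mem _ h.1 _ h2.1) _ (imp_trans _ _ _),
        hF.up _ (hF.mul_mem _ h2.2 _ h.2) _ (imp_trans _ _ _)⟩ }

theorem mul_imp_mul (x y a b : L) : (x ⇨ y) * (a ⇨ b) ≤ (x * a) ⇨ (y * b) := by
  rw [le_imp, mul_mul_mul_comm]
  exact mul_le_mul' (imp_mul_le _ _) (imp_mul_le _ _)

theorem imp_imp_imp (x y a b : L) : (y ⇨ x) * (a ⇨ b) ≤ (x ⇨ a) ⇨ (y ⇨ b) := by
  rw [le_imp, mul_right_comm]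
  exact (mul_le_mul_left (imp_trans y x a) _).trans (imp_trans y a b)

/-- The quotient of a BL-algebra by a filter. -/
def FilterQuotient (F : Set L) (hF : IsFilter F) : Type u := Quotient (filterSetoid F hF)

instance (F : Set L) (hF : IsFilter F) : BLAlgebra (FilterQuotient F hF) where
  mul := Quotient.map₂ (· * ·) fun _ _ h _ _ h2 =>
    ⟨hF.up _ (hF.mul_mem _ h.1 _ h2.1) _ (mul_imp_mul _ _ _ _),
      hF.up _ (hF.mul_mem _ h.2 _ h2.2) _ (mul_imp_mul _ _ _ _)⟩
  himp := Quotient.map₂ (· ⇨ ·) fun _ _ h _ _ h2 =>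
    ⟨hF.up _ (hF.mul_mem _ h.2 _ h2.1) _ (imp_imp_imp _ _ _ _),
      hF.up _ (hF.mul_mem _ h.1 _ h2.2) _ (imp_imp_imp _ _ _ _)⟩
  one := Quotient.mk _ 1
  zero := Quotient.mk _ 0
  mul_assoc := by
    rintro ⟨x⟩ ⟨y⟩ ⟨z⟩; exact congrArg (Quotient.mk _) (mul_assoc x y z)
  mul_comm := by
    rintro ⟨x⟩ ⟨y⟩; exact congrArg (Quotient.mk _) (mul_comm x y)
  one_mul := by
    rintro ⟨x⟩; exact congrArg (Quotient.mk _) (one_mul x)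
  mul_one := by
    rintro ⟨x⟩; exact congrArg (Quotient.mk _) (mul_one x)
  imp_refl := by
    rintro ⟨x⟩; exact congrArg (Quotient.mk _) (imp_refl x)
  mul_imp_comm := by
    rintro ⟨x⟩ ⟨y⟩; exact congrArg (Quotient.mk _) (mul_imp_comm x y)
  imp_imp := by
    rintro ⟨x⟩ ⟨y⟩ ⟨z⟩; exact congrArg (Quotient.mk _) (imp_imp x y z)
  zero_le := by
    rintro ⟨x⟩; exact congrArg (Quotient.mk _) (zero_le x)
  prelinear := by
    rintro ⟨x⟩ ⟨y⟩ ⟨z⟩; exact congrArg (Quotient.mk _) (prelinear x y z)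

/-- The order of a BL-algebra is linear. -/
def IsChain (C : Type u) [BLAlgebra C] : Prop := ∀ x y : C, x ≤ y ∨ y ≤ x

/-- An inequality which holds in all linearly ordered quotients holds. -/
theorem le_of_chains {x y : L}
    (h : ∀ (C : Type u) [BLAlgebra C] (f : Hom L C), IsChain C → f.toFun x ≤ f.toFun y) :
    x ≤ y := by
  by_contra hne
  obtain ⟨F, hF, htF, hpr⟩ := exists_prime (t := x ⇨ y) hne
  let f : Hom L (FilterQuotient F hF) :=
    { toFun := Quotient.mk (filterSetoid F hF)
      map_zero := rfl
      map_one := rfl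
      map_mul := fun _ _ => rfl
      map_imp := fun _ _ => rfl }
  have h1 : ∀ a b : L, a ⇨ b ∈ F → f.toFun a ≤ f.toFun b := by
    intro a b hab
    refine Quotient.sound ⟨?_, ?_⟩
    · rw [imp_one]; exact hF.one_mem
    · rwa [one_imp]
  have hc : IsChain (FilterQuotient F hF) := by
    rintro ⟨a⟩ ⟨b⟩
    exact (hpr a b).imp (h1 a b) (h1 b a)
  have h2 := (Quotient.exact (h _ f hc)).2
  rw [one_imp] at h2
  exact htF h2

/-- Two elements which agree in all linearly ordered quotients are equal. -/
theorem eq_of_chains {x y : L}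
    (h : ∀ (C : Type u) [BLAlgebra C] (f : Hom L C), IsChain C → f.toFun x = f.toFun y) :
    x = y :=
  le_antisymm (le_of_chains fun C _ f hC => (h C f hC).le)
    (le_of_chains fun C _ f hC => (h C f hC).ge)

/-! ### Chains -/

theorem regular_or_dense (hL : IsChain L) (x : L) : neg (neg x) = x ∨ neg x = 0 := by
  set y := neg (neg x) with hy
  set d := y ⇨ x with hd
  have hxy : y * d = x := mul_imp_of_le (le_neg_neg x)
  have hnx : d ⇨ neg x = neg x := by
    rw [← neg_neg_neg x, ← neg_mul, mul_comm, ← hy, hxy, hy, neg_neg_neg]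
  have hxd : x ≤ d := le_imp_self _ _
  have hd0 : neg d = 0 ∨ neg x = 1 := by
    rcases hL d (neg x) with h | h
    · right; rw [← hnx, le_def.1 h]
    · left
      have h1 : d * neg x = neg x := by
        have := mul_imp_of_le h
        rwa [hnx] at this
      have h2 : neg d ≤ neg x := neg_anti hxd
      have h3 : neg x * (neg x ⇨ neg d) = neg d := mul_imp_of_le h2
      have h4 : d * neg d = 0 := le_neg_iff.1 (le_neg_neg d)
      rw [← h3, ← mul_assoc, h1, h3] at h4
      exact h4
  rcases hd0 with h | h
  · by_cases h1 : neg x = 0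
    · exact Or.inr h1
    · left
      have hdy : d ⇨ y = y := by
        have e : d ⇨ neg (neg x) = neg x ⇨ neg d := imp_neg_comm d (neg x)
        rw [hy, e, h]; rfl
      rcases hL y d with h2 | h2
      · have := mul_imp_of_le h2
        rw [hdy, mul_comm, hxy] at this
        exact this.symm
      · exfalso
        apply h1
        have := neg_anti h2
        rwa [h, le_zero, hy, neg_neg_neg] at this
  · left
    rw [hy, h, neg_one', (neg_eq_one.1 h)]

theorem add_of_dense (hL : IsChain L) {x y : L} (hx : neg x = 0) (hy : y ≠ 0) : x + y = 1 := by
  rw [add_def, hx, zero_imp, ← one_le_iff, le_inf_iff]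
  refine ⟨le_rfl, ?_⟩
  rw [one_le_iff, ← le_def]
  rcases hL (neg y) x with h | h
  · exact h
  · exfalso
    have := neg_anti h
    rw [hx, le_zero] at this
    exact hy (le_zero.1 (this ▸ le_neg_neg y))

theorem mul_of_dense (hL : IsChain L) {x y : L} (hx : neg x = 0) (hy : neg y ≠ 0) :
    x * y = y := by
  have hyr : neg (neg y) = y := (regular_or_dense hL y).resolve_right hy
  have h1 : x ⇨ y = y := by
    rw [← hyr, imp_neg_comm, hx]; rfl
  rcases hL y x with h | h
  · have := mul_imp_of_le h
    rwa [h1] at this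
  · exact absurd (le_zero.1 (hx ▸ neg_anti h)) hy

theorem reg_add {x y : L} (hx : neg (neg x) = x) (hy : neg (neg y) = y) :
    x + y = neg (neg x * neg y) := by
  have h1 : neg x ⇨ y = neg (neg x * neg y) := by rw [neg_mul, hy]
  have h2 : neg y ⇨ x = neg (neg x * neg y) := by rw [mul_comm, neg_mul, hx]
  rw [add_def, h1, h2, inf_idem]

theorem reg_add_imp {x y : L} (hx : neg (neg x) = x) (hy : neg (neg y) = y) :
    x + y = neg x ⇨ y := by
  rw [reg_add hx hy, neg_mul, hy]

theorem reg_add_reg {x y : L} (hx : neg (neg x) = x) (hy : neg (neg y) = y) :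
    neg (neg (x + y)) = x + y := by
  rw [reg_add hx hy, neg_neg_neg]

theorem reg_mul (hL : IsChain L) {x y : L} (hx : neg (neg x) = x) (hy : neg (neg y) = y) :
    neg (neg (x * y)) = x * y := by
  rcases regular_or_dense hL (x * y) with h | h
  · exact h
  · have h1 : neg x = 0 := le_zero.1 (h ▸ neg_anti (mul_le_left x y))
    have h2 : neg y = 0 := le_zero.1 (h ▸ neg_anti (mul_le_right x y))
    rw [← hx, ← hy, h1, h2, neg_zero', one_mul, neg_one', neg_zero']

theorem neg_neg_mul_left (x y : L) : neg (neg (neg x) * y) = neg (x * y) := by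
  rw [mul_comm, neg_mul, neg_neg_neg, ← neg_mul, mul_comm]

theorem dense_mul {x y : L} (hx : neg x = 0) (hy : neg y = 0) : neg (x * y) = 0 := by
  rw [neg_mul, hy]; exact hx

theorem add_eq_one_or (hL : IsChain L) (x y : L) : x + y = 1 ∨ x * y = 0 := by
  rcases hL (neg x) y with h | h
  · rcases hL (neg y) x with h2 | h2
    · left
      rw [add_def, le_def.1 h, le_def.1 h2, inf_idem]
    · right; exact le_neg_iff.1 h2
  · right; rw [mul_comm]; exact le_neg_iff.1 h

theorem add_assoc_of_chain (hL : IsChain L) (x y z : L) : x + y + z = x + (y + z) := by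
  by_cases hx : x = 0
  · rw [hx, zero_add', zero_add']
  by_cases hy : y = 0
  · rw [hy, zero_add', add_zero']
  by_cases hz : z = 0
  · rw [hz, add_zero', add_zero']
  have ne : ∀ a b : L, a ≠ 0 → a + b ≠ 0 := fun a b h h2 =>
    h (le_zero.1 (h2 ▸ le_add_left' a b))
  rcases regular_or_dense hL x with hx1 | hx1
  · rcases regular_or_dense hL y with hy1 | hy1
    · rcases regular_or_dense hL z with hz1 | hz1
      · rw [reg_add (reg_add_reg hx1 hy1) hz1, reg_add hx1 (reg_add_reg hy1 hz1),
          reg_add hx1 hy1, reg_add hy1 hz1, neg_neg_mul_left, mul_comm (neg x) (neg (neg _)),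
          neg_neg_mul_left, mul_comm _ (neg x), mul_assoc]
      · rw [blAdd_comm _ z, add_of_dense hL hz1 (ne x y hx), blAdd_comm y z,
          add_of_dense hL hz1 hy, add_one']
    · rw [blAdd_comm x y, add_of_dense hL hy1 hx, add_of_dense hL hy1 hz, one_add', add_one']
  · rw [add_of_dense hL hx1 hy, one_add', add_of_dense hL hx1 (ne y z hy)]

/-- With the addition `x + y = (x̄ → y) ∧ (ȳ → x)`, a BL-algebra is a commutative monoid. -/
instance (priority := 50) : AddCommMonoid L where
  add_assoc x y z := eq_of_chains fun C _ f hC => by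
    simp only [f.map_add, add_assoc_of_chain hC]
  zero_add := zero_add'
  add_zero := add_zero'
  add_comm := blAdd_comm
  nsmul := nsmulRec

theorem neg_neg_add (hL : IsChain L) (x y : L) :
    neg (neg (x + y)) = neg (neg x) + neg (neg y) := by
  by_cases hx : x = 0
  · rw [hx, zero_add', neg_zero', neg_one', zero_add']
  by_cases hy : y = 0
  · rw [hy, add_zero', neg_zero', neg_one', add_zero']
  rcases regular_or_dense hL x with hx1 | hx1
  · rcases regular_or_dense hL y with hy1 | hy1
    · rw [reg_add_reg hx1 hy1, hx1, hy1]
    · rw [hy1, blAdd_comm x y, add_of_dense hL hy1 hx, neg_one', neg_zero', add_one']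
  · rw [hx1, add_of_dense hL hx1 hy, neg_one', neg_zero', one_add']

theorem neg_neg_mul (hL : IsChain L) (x y : L) :
    neg (neg (x * y)) = neg (neg x) * neg (neg y) := by
  rw [← reg_mul hL (neg_neg_neg (neg x)) (neg_neg_neg (neg y)), neg_neg_mul_left,
    mul_comm x (neg (neg y)), neg_neg_mul_left, mul_comm]

theorem wajsberg {p q : L} (hp : neg (neg p) = p) (hq : neg (neg q) = q) (h : p ≤ q) :
    (q ⇨ p) ⇨ p = q := by
  have e : q ⇨ p = neg p ⇨ neg q := by
    conv_lhs => rw [← hp]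
    rw [imp_neg_comm]
  have e2 : (q ⇨ p) ⇨ p = neg p ⇨ neg (q ⇨ p) := by
    conv_lhs => rw [← hp, imp_neg_comm, hp]
  rw [e2, ← neg_mul, e, mul_imp_of_le (neg_anti h), hq]

theorem imp_of_le_of_le {x p q : L} (h : x ≤ p) (h2 : p ≤ q) : q ⇨ x = (q ⇨ p) * (p ⇨ x) := by
  rw [← mul_imp_of_le (imp_mono (le_refl q) h), imp_imp, mul_comm (q ⇨ p) q, mul_imp_of_le h2]

theorem imp_imp_exchange {x p q : L} (hp : neg (neg p) = p) (hq : neg (neg q) = q)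
    (h : x ≤ p) (h2 : p ≤ q) : (p ⇨ x) ⇨ q = (q ⇨ x) ⇨ p := by
  rw [imp_of_le_of_le h h2, ← imp_imp, imp_left_comm]
  congr 1
  exact (wajsberg hp hq h2).symm

theorem reg_exchange_zero (hL : IsChain L) {x y z : L} (hx : neg (neg x) = x)
    (hy : neg (neg y) = y) (hz : neg (neg z) = z) (h : x * y = 0) (h2 : x * z = 0) :
    (x + y) * z = (x + z) * y := by
  have e1 : x + y = neg y ⇨ x := by rw [add_comm, reg_add_imp hy hx]
  have e2 : x + z = neg z ⇨ x := by rw [add_comm, reg_add_imp hz hx]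
  rw [← reg_mul hL (reg_add_reg hx hy) hz, ← reg_mul hL (reg_add_reg hx hz) hy,
    neg_mul, neg_mul, e1, e2]
  congr 1
  have hxy : x ≤ neg y := le_neg_iff.2 h
  have hxz : x ≤ neg z := le_neg_iff.2 h2
  rcases hL (neg y) (neg z) with h3 | h3
  · exact imp_imp_exchange (neg_neg_neg y) (neg_neg_neg z) hxy h3
  · exact (imp_imp_exchange (neg_neg_neg z) (neg_neg_neg y) hxz h3).symm

theorem reg_exchange_one (hL : IsChain L) {x y z : L} (hx : neg (neg x) = x)
    (hy : neg (neg y) = y) (hz : neg (neg z) = z) (h : x + y = 1) (h2 : x + z = 1) :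
    x * y + z = x * z + y := by
  have e : ∀ a b c : L, neg (neg a) = a → neg (neg b) = b → neg (neg c) = c →
      a * b + c = neg ((neg a + neg b) * neg c) := by
    intro a b c ha hb hc
    rw [reg_add (reg_mul hL ha hb) hc, reg_add (neg_neg_neg a) (neg_neg_neg b), ha, hb]
  have z0 : ∀ a b : L, neg (neg a) = a → neg (neg b) = b → a + b = 1 → neg a * neg b = 0 := by
    intro a b ha hb hab
    rw [reg_add ha hb] at hab
    exact neg_eq_one.1 hab
  rw [e x y z hx hy hz, e x z y hx hz hy,
    reg_exchange_zero hL (neg_neg_neg x) (neg_neg_neg y) (neg_neg_neg z)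
      (z0 x y hx hy h) (z0 x z hx hz h2)]

theorem reg_exchange_mixed {x y z : L} (hL : IsChain L) (hx : neg (neg x) = x)
    (hy : neg (neg y) = y) (hz : neg (neg z) = z) (h : x + y = 1) (h2 : x * z = 0) :
    x * y + z = (x + z) * y := by
  have h3 : neg x ≤ y := by rwa [reg_add_imp hx hy] at h
  have h4 : z ≤ neg x := by rw [le_neg_iff, mul_comm]; exact h2
  have e1 : x * y + z = (y ⇨ neg x) ⇨ z := by
    rw [reg_add_imp (reg_mul hL hx hy) hz, mul_comm, neg_mul]
  have h5 : (y ⇨ neg x) ⇨ z ≤ y := by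
    refine (imp_mono le_rfl h4).trans ?_
    rw [wajsberg (neg_neg_neg x) hy h3]
  rw [e1, ← mul_imp_of_le h5, imp_imp, mul_imp_of_le h3, reg_add_imp hx hz, mul_comm]

theorem exchange_of_reg (hL : IsChain L) {x y z : L} (hx : neg (neg x) = x)
    (hy : neg (neg y) = y) (hz : neg (neg z) = z) :
    x * y + (x + y) * z = x * z + (x + z) * y := by
  rcases add_eq_one_or hL x y with h | h <;> rcases add_eq_one_or hL x z with h2 | h2
  · rw [h, h2, one_mul, one_mul, reg_exchange_one hL hx hy hz h h2]
  · rw [h, h2, one_mul, zero_add, reg_exchange_mixed hL hx hy hz h h2]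
  · rw [h, h2, one_mul, zero_add, reg_exchange_mixed hL hx hz hy h2 h]
  · rw [h, h2, zero_add, zero_add, reg_exchange_zero hL hx hy hz h h2]

theorem exchange_of_dense (hL : IsChain L) {x y z : L} (hx : x = 0 ∨ neg x = 0)
    (hy : y = 0 ∨ neg y = 0) (hz : z = 0 ∨ neg z = 0) :
    x * y + (x + y) * z = x * z + (x + z) * y := by
  by_cases hx0 : x = 0
  · subst hx0
    rw [zero_mul', zero_mul', zero_add, zero_add, zero_add, zero_add, mul_comm]
  by_cases hy0 : y = 0
  · subst hy0
    rw [mul_zero', mul_zero', zero_add, add_zero, add_zero]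
  by_cases hz0 : z = 0
  · subst hz0
    rw [mul_zero', mul_zero', zero_add, add_zero, add_zero]
  have hx := hx.resolve_left hx0
  have hy := hy.resolve_left hy0
  have hz := hz.resolve_left hz0
  rw [add_of_dense hL hx hy0, add_of_dense hL hx hz0, one_mul, one_mul,
    add_of_dense hL (dense_mul hx hy) hz0, add_of_dense hL (dense_mul hx hz) hy0]

theorem reg_eq_of_add_eq_one {a r : L} (ha : neg (neg a) = a) (hr : neg (neg r) = r)
    (h : a + r = 1) : a = neg (r * neg (a * r)) := by
  have h3 : neg a ≤ r := by rwa [reg_add_imp ha hr] at h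
  rw [mul_comm a r, neg_mul r a, mul_imp_of_le h3, ha]

theorem reg_cancel (hL : IsChain L) {x y r : L} (hx : neg (neg x) = x)
    (hy : neg (neg y) = y) (hr : neg (neg r) = r) (h : x + r = y + r) (h2 : x * r = y * r) :
    x = y := by
  have key1 : ∀ a : L, neg (neg a) = a → a * r = 0 → a = neg r * (a + r) := by
    intro a ha h0
    rw [add_comm, reg_add_imp hr ha, mul_imp_of_le (le_neg_iff.2 h0)]
  rcases add_eq_one_or hL x r with h3 | h3
  · rw [reg_eq_of_add_eq_one hx hr h3, reg_eq_of_add_eq_one hy hr (h ▸ h3), h2]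
  · rw [key1 x hx h3, key1 y hy (h2 ▸ h3), h]

theorem eq_one_of_mul_eq {y r : L} (hy : neg (neg y) = y)
    (hr : neg (neg r) = r) (h : y + r = 1) (h2 : y * r = r) : y = 1 := by
  rw [reg_eq_of_add_eq_one hy hr h, h2, le_neg_iff.1 (le_neg_neg r), neg_zero']

/-! ### Good sequences -/

/-- A good sequence of a BL-algebra: `aᵢ + aᵢ₊₁ = aᵢ` for all `i`, and almost all terms are `0`.
The term `a₁` is stored at the index `0`, the term `a₂` at the index `1`, and so on. -/
structure IsGood (a : ℕ → L) : Prop where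
  add_succ : ∀ i, a i + a (i + 1) = a i
  eventually_zero : ∃ n, ∀ r, n ≤ r → a r = 0

/-- The sum of two sequences, `cᵢ = aᵢ + (aᵢ₋₁ ⊗ b₁) + ⋯ + (a₁ ⊗ bᵢ₋₁) + bᵢ`. -/
def seqAdd (a b : ℕ → L) (n : ℕ) : L :=
  a n + ∑ j ∈ Finset.range n, a (n - 1 - j) * b j + b n

/-- The sequence `(x, a₁, a₂, …)`. -/
def cons (x : L) (a : ℕ → L) : ℕ → L
  | 0 => x
  | n + 1 => a n

/-- The sequence `(x) = (x, 0, 0, …)`. -/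
def single (x : L) : ℕ → L := cons x fun _ => 0

theorem seqAdd_comm (a b : ℕ → L) : seqAdd a b = seqAdd b a := by
  funext n
  have : ∑ j ∈ Finset.range n, a (n - 1 - j) * b j = ∑ j ∈ Finset.range n, b (n - 1 - j) * a j := by
    rw [← Finset.sum_range_reflect]
    refine Finset.sum_congr rfl fun j hj => ?_
    have hj := Finset.mem_range.1 hj
    rw [mul_comm, show n - 1 - (n - 1 - j) = j by omega]
  rw [seqAdd, seqAdd, this]
  abel

theorem single_zero : single (0 : L) = fun _ => 0 := by
  funext n; cases n <;> rfl

theorem seqAdd_single (x : L) (b : ℕ → L) :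
    seqAdd (single x) b = cons (x + b 0) fun n => x * b n + b (n + 1) := by
  funext n
  cases n with
  | zero => simp [seqAdd, single, cons]
  | succ n =>
    have h : ∀ j ∈ Finset.range n, single x (n + 1 - 1 - j) * b j = 0 := by
      intro j hj
      have hj := Finset.mem_range.1 hj
      obtain ⟨m, hm⟩ : ∃ m, n + 1 - 1 - j = m + 1 := ⟨n - 1 - j, by omega⟩
      rw [hm]; exact zero_mul' _
    rw [seqAdd, Finset.sum_range_succ, Finset.sum_eq_zero h]
    simp [single, cons]

theorem seqAdd_zero (a : ℕ → L) : seqAdd a (fun _ => 0) = a := by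
  rw [seqAdd_comm, ← single_zero, seqAdd_single]
  funext n
  cases n with
  | zero => exact zero_add _
  | succ n => simp only [cons, zero_mul', zero_add]

theorem seqAdd_cons_one (a : ℕ → L) {b : ℕ → L} (hb : IsGood b) :
    seqAdd (cons 1 a) b = cons 1 (seqAdd a b) := by
  funext n
  cases n with
  | zero => simp [seqAdd, cons, one_add']
  | succ n =>
    have h : ∑ j ∈ Finset.range n, cons 1 a (n + 1 - 1 - j) * b j =
        ∑ j ∈ Finset.range n, a (n - 1 - j) * b j := by
      refine Finset.sum_congr rfl fun j hj => ?_
      have hj := Finset.mem_range.1 hj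
      rw [show n + 1 - 1 - j = (n - 1 - j) + 1 by omega]; rfl
    rw [seqAdd, Finset.sum_range_succ, h]
    simp only [cons, Nat.add_sub_cancel, Nat.sub_self, one_mul, seqAdd]
    rw [← add_assoc, add_assoc _ (b n), hb.add_succ]

theorem seqAdd_mono {a b c d : ℕ → L} (h : a ≤ b) (h2 : c ≤ d) : seqAdd a c ≤ seqAdd b d := by
  have hsum : ∀ (f g : ℕ → L), (∀ j, f j ≤ g j) → ∀ n,
      ∑ j ∈ Finset.range n, f j ≤ ∑ j ∈ Finset.range n, g j := by
    intro f g hfg n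
    induction n with
    | zero => exact le_rfl
    | succ n ih =>
      rw [Finset.sum_range_succ, Finset.sum_range_succ]
      exact add_mono ih (hfg n)
  intro n
  exact add_mono (add_mono (h n) (hsum _ _ (fun j => mul_le_mul' (h _) (h2 j)) n)) (h2 n)

theorem isGood_single (x : L) : IsGood (single x) where
  add_succ i := by cases i <;> simp [single, cons]
  eventually_zero := ⟨1, fun r hr => by
    obtain ⟨m, rfl⟩ : ∃ m, r = m + 1 := ⟨r - 1, by omega⟩
    rfl⟩

theorem isGood_cons_one {a : ℕ → L} (ha : IsGood a) : IsGood (cons 1 a) where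
  add_succ i := by
    cases i with
    | zero => exact one_add' _
    | succ i => exact ha.add_succ i
  eventually_zero := by
    obtain ⟨n, hn⟩ := ha.eventually_zero
    refine ⟨n + 1, fun r hr => ?_⟩
    obtain ⟨m, rfl⟩ : ∃ m, r = m + 1 := ⟨r - 1, by omega⟩
    exact hn m (by omega)

theorem eq_one_or_eq_zero (hL : IsChain L) {x y : L} (h : x + y = x) : x = 1 ∨ y = 0 := by
  by_cases hy : y = 0
  · exact Or.inr hy
  left
  rcases regular_or_dense hL x with hx1 | hx1
  · rcases regular_or_dense hL y with hy1 | hy1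
    · rcases add_eq_one_or hL x y with h1 | h1
      · rw [← h, h1]
      · refine absurd (reg_cancel hL hy1 (by rw [neg_zero', neg_one']) hx1 ?_ ?_) hy
        · rw [zero_add, add_comm, h]
        · rw [zero_mul', mul_comm, h1]
    · by_cases hx : x = 0
      · rw [hx, zero_add] at h; exact absurd h hy
      · rw [← h, add_comm, add_of_dense hL hy1 hx]
  · rw [← h, add_of_dense hL hx1 hy]

theorem good_induction (hL : IsChain L) {P : (ℕ → L) → Prop} (h1 : ∀ x, P (single x))
    (h2 : ∀ b, IsGood b → P b → P (cons 1 b)) {a : ℕ → L} (ha : IsGood a) : P a := by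
  obtain ⟨n, hn⟩ := ha.eventually_zero
  induction n generalizing a with
  | zero =>
    have : a = single 0 := by rw [single_zero]; funext r; exact hn r (Nat.zero_le r)
    rw [this]; exact h1 0
  | succ n ih =>
    rcases eq_one_or_eq_zero hL (ha.add_succ 0) with h | h
    · have e : a = cons 1 fun i => a (i + 1) := by
        funext i; cases i with
        | zero => exact h
        | succ i => rfl
      have hg : IsGood fun i => a (i + 1) :=
        ⟨fun i => ha.add_succ (i + 1), n, fun r hr => hn (r + 1) (by omega)⟩
      rw [e]
      exact h2 _ hg (ih hg fun r hr => hn (r + 1) (by omega))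
    · have h0 : ∀ i, a (i + 1) = 0 := by
        intro i
        induction i with
        | zero => exact h
        | succ i ihi =>
          have := ha.add_succ (i + 1)
          rwa [ihi, zero_add] at this
      have e : a = single (a 0) := by
        funext i; cases i with
        | zero => rfl
        | succ i => exact h0 i
      rw [e]; exact h1 _

theorem good_total (hL : IsChain L) {a b : ℕ → L} (ha : IsGood a) (hb : IsGood b) :
    a ≤ b ∨ b ≤ a := by
  revert b
  refine good_induction hL (P := fun a => ∀ {b}, IsGood b → a ≤ b ∨ b ≤ a) ?_ ?_ ha
  · intro x b hb
    refine good_induction hL (P := fun b => single x ≤ b ∨ b ≤ single x) ?_ ?_ hb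
    · intro y
      refine (hL x y).imp (fun h i => ?_) (fun h i => ?_)
      · cases i with
        | zero => exact h
        | succ i => exact le_rfl
      · cases i with
        | zero => exact h
        | succ i => exact le_rfl
    · intro b _ _
      left
      intro i
      cases i with
      | zero => exact le_one _
      | succ i => exact zero_le _
  · intro a _ ih b hb
    refine good_induction hL (P := fun b => cons 1 a ≤ b ∨ b ≤ cons 1 a) ?_ ?_ hb
    · intro y
      right
      intro i
      cases i with
      | zero => exact le_one _
      | succ i => exact zero_le _
    · intro b hb _
      refine (ih hb).imp (fun h i => ?_) (fun h i => ?_)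
      · cases i with
        | zero => exact le_rfl
        | succ i => exact h i
      · cases i with
        | zero => exact le_rfl
        | succ i => exact h i

theorem isGood_add_of_chain (hL : IsChain L) {a b : ℕ → L} (ha : IsGood a) (hb : IsGood b) :
    IsGood (seqAdd a b) := by
  refine good_induction hL (P := fun a => IsGood (seqAdd a b)) ?_ ?_ ha
  · intro x
    refine good_induction hL (P := fun b => IsGood (seqAdd (single x) b)) ?_ ?_ hb
    · intro y
      rw [seqAdd_single]
      refine ⟨fun i => ?_, 2, fun r hr => ?_⟩
      · match i with
        | 0 =>
          simp only [single, cons, add_zero]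
          rcases add_eq_one_or hL x y with h | h
          · rw [h, one_add']
          · rw [h, add_zero]
        | 1 => simp only [single, cons, add_zero, mul_zero']
        | i + 2 => simp only [single, cons, add_zero, mul_zero']
      · obtain ⟨m, rfl⟩ : ∃ m, r = m + 2 := ⟨r - 2, by omega⟩
        simp only [single, cons, add_zero, mul_zero']
    · intro b _ h
      rw [seqAdd_comm, seqAdd_cons_one _ (isGood_single x), seqAdd_comm]
      exact isGood_cons_one h
  · intro a _ h
    rw [seqAdd_cons_one _ hb]
    exact isGood_cons_one h

theorem Hom.map_seqAdd {C : Type u} [BLAlgebra C] (f : Hom L C) (a b : ℕ → L) (n : ℕ) :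
    f.toFun (seqAdd a b n) = seqAdd (fun i => f.toFun (a i)) (fun i => f.toFun (b i)) n := by
  have hsum : ∀ (g : ℕ → L) n, f.toFun (∑ j ∈ Finset.range n, g j) =
      ∑ j ∈ Finset.range n, f.toFun (g j) := by
    intro g n
    induction n with
    | zero => exact f.map_zero
    | succ n ih => rw [Finset.sum_range_succ, Finset.sum_range_succ, f.map_add, ih]
  simp only [seqAdd, f.map_add, hsum, f.map_mul]

theorem Hom.map_isGood {C : Type u} [BLAlgebra C] (f : Hom L C) {a : ℕ → L} (ha : IsGood a) :
    IsGood fun i => f.toFun (a i) where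
  add_succ i := by rw [← f.map_add, ha.add_succ]
  eventually_zero := by
    obtain ⟨n, hn⟩ := ha.eventually_zero
    exact ⟨n, fun r hr => by rw [hn r hr, f.map_zero]⟩

theorem isGood_add {a b : ℕ → L} (ha : IsGood a) (hb : IsGood b) : IsGood (seqAdd a b) where
  add_succ i := eq_of_chains fun C _ f hC => by
    rw [f.map_add, f.map_seqAdd, f.map_seqAdd]
    exact (isGood_add_of_chain hC (f.map_isGood ha) (f.map_isGood hb)).add_succ i
  eventually_zero := by
    obtain ⟨n, hn⟩ := ha.eventually_zero
    obtain ⟨m, hm⟩ := hb.eventually_zero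
    refine ⟨n + m, fun r hr => ?_⟩
    rw [seqAdd, hn r (by omega), hm r (by omega), Finset.sum_eq_zero, add_zero, add_zero]
    intro j hj
    have hj := Finset.mem_range.1 hj
    by_cases h : m ≤ j
    · rw [hm j h, mul_zero']
    · rw [hn _ (by omega), zero_mul']

theorem isGood_sup {a b : ℕ → L} (ha : IsGood a) (hb : IsGood b) : IsGood (a ⊔ b) where
  add_succ i := eq_of_chains fun C _ f hC => by
    rw [f.map_add]
    simp only [Pi.sup_apply, f.map_sup]
    rcases good_total hC (f.map_isGood ha) (f.map_isGood hb) with h | h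
    · rw [sup_eq_right.2 (h i), sup_eq_right.2 (h (i + 1))]
      exact (f.map_isGood hb).add_succ i
    · rw [sup_eq_left.2 (h i), sup_eq_left.2 (h (i + 1))]
      exact (f.map_isGood ha).add_succ i
  eventually_zero := by
    obtain ⟨n, hn⟩ := ha.eventually_zero
    obtain ⟨m, hm⟩ := hb.eventually_zero
    refine ⟨n + m, fun r hr => ?_⟩
    rw [Pi.sup_apply, hn r (by omega), hm r (by omega), sup_idem]

theorem isGood_inf {a b : ℕ → L} (ha : IsGood a) (hb : IsGood b) : IsGood (a ⊓ b) where
  add_succ i := eq_of_chains fun C _ f hC => by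
    rw [f.map_add]
    simp only [Pi.inf_apply, f.map_inf]
    rcases good_total hC (f.map_isGood ha) (f.map_isGood hb) with h | h
    · rw [inf_eq_left.2 (h i), inf_eq_left.2 (h (i + 1))]
      exact (f.map_isGood ha).add_succ i
    · rw [inf_eq_right.2 (h i), inf_eq_right.2 (h (i + 1))]
      exact (f.map_isGood hb).add_succ i
  eventually_zero := by
    obtain ⟨n, hn⟩ := ha.eventually_zero
    obtain ⟨m, hm⟩ := hb.eventually_zero
    refine ⟨n + m, fun r hr => ?_⟩
    rw [Pi.inf_apply, hn r (by omega), hm r (by omega), inf_idem]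

variable (L) in
/-- The set `M_L` of good sequences of the BL-algebra `L`. -/
def GoodSeq : Type u := {a : ℕ → L // IsGood a}

namespace GoodSeq

/-- Good sequences are compared term by term. -/
instance : PartialOrder (GoodSeq L) := inferInstanceAs (PartialOrder {a : ℕ → L // IsGood a})

/-- The lattice operations of good sequences are computed term by term. -/
instance : Lattice (GoodSeq L) where
  sup a b := ⟨a.1 ⊔ b.1, isGood_sup a.2 b.2⟩
  inf a b := ⟨a.1 ⊓ b.1, isGood_inf a.2 b.2⟩
  le_sup_left a b := show a.1 ≤ a.1 ⊔ b.1 from le_sup_left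
  le_sup_right a b := show b.1 ≤ a.1 ⊔ b.1 from le_sup_right
  sup_le a b c h h2 := show a.1 ⊔ b.1 ≤ c.1 from sup_le h h2
  inf_le_left a b := show a.1 ⊓ b.1 ≤ a.1 from inf_le_left
  inf_le_right a b := show a.1 ⊓ b.1 ≤ b.1 from inf_le_right
  le_inf a b c h h2 := show a.1 ≤ b.1 ⊓ c.1 from le_inf h h2

instance : Add (GoodSeq L) where
  add a b := ⟨seqAdd a.1 b.1, isGood_add a.2 b.2⟩

/-- The good sequence `(x) = (x, 0, 0, …)`. -/
def of (x : L) : GoodSeq L := ⟨single x, isGood_single x⟩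

instance : Zero (GoodSeq L) where
  zero := of 0

protected theorem add_comm (a b : GoodSeq L) : a + b = b + a := Subtype.ext (seqAdd_comm a.1 b.1)

protected theorem add_zero (a : GoodSeq L) : a + 0 = a :=
  Subtype.ext ((congrArg (seqAdd a.1) single_zero).trans (seqAdd_zero a.1))

protected theorem zero_add (a : GoodSeq L) : 0 + a = a := by
  rw [GoodSeq.add_comm, GoodSeq.add_zero]

protected theorem add_le_add {a b c d : GoodSeq L} (h : a ≤ b) (h2 : c ≤ d) : a + c ≤ b + d :=
  seqAdd_mono (show a.1 ≤ b.1 from h) (show c.1 ≤ d.1 from h2)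

end GoodSeq

/-! ### Cancellation and associativity for good sequences of chains

The addition of good sequences of a chain is not associative in general. It is associative on the
sequences all of whose terms are regular (`¬¬x = x`) and on those all of whose terms are `0` or
dense (`¬x = 0`). -/

theorem seqAdd_cons_one_right {a : ℕ → L} (b : ℕ → L) (ha : IsGood a) :
    seqAdd a (cons 1 b) = cons 1 (seqAdd a b) := by
  rw [seqAdd_comm, seqAdd_cons_one _ ha, seqAdd_comm]

theorem cons_inj {M : Type u} {x y : M} {a b : ℕ → M} (h : cons x a = cons y b) : x = y ∧ a = b :=
  ⟨congrFun h 0, funext fun n => congrFun h (n + 1)⟩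

theorem single_one : single (1 : L) = cons 1 (single 0) := by
  rw [single_zero]; rfl

/-- A set of elements of a chain on which the addition of good sequences is associative. -/
structure Clan (C : Type u) [BLAlgebra C] where
  chain : IsChain C
  p : C → Prop
  zero : p 0
  add : ∀ x y, p x → p y → p (x + y)
  mul : ∀ x y, p x → p y → p (x * y)
  exchange : ∀ x y z, p x → p y → p z → x * y + (x + y) * z = x * z + (x + z) * y

/-- The regular elements of a chain. -/
def regClan (hL : IsChain L) : Clan L where
  chain := hL
  p x := neg (neg x) = x
  zero := by rw [neg_zero', neg_one']
  add _ _ := reg_add_reg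
  mul _ _ := reg_mul hL
  exchange _ _ _ := exchange_of_reg hL

/-- The elements of a chain which are dense or `0`. -/
def denseClan (hL : IsChain L) : Clan L where
  chain := hL
  p x := x = 0 ∨ neg x = 0
  zero := Or.inl rfl
  add x y hx hy := by
    rcases hx with rfl | hx
    · rwa [zero_add]
    · by_cases h : y = 0
      · rw [h, add_zero]; exact Or.inr hx
      · rw [add_of_dense hL hx h]; exact Or.inr neg_one'
  mul x y hx hy := by
    rcases hx with rfl | hx
    · exact Or.inl (zero_mul' y)
    · rcases hy with rfl | hy
      · exact Or.inl (mul_zero' x)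
      · exact Or.inr (dense_mul hx hy)
  exchange _ _ _ := exchange_of_dense hL

theorem Clan.seqAdd_mem (N : Clan L) {a b : ℕ → L} (ha : ∀ i, N.p (a i)) (hb : ∀ i, N.p (b i))
    (n : ℕ) : N.p (seqAdd a b n) := by
  have : ∀ (g : ℕ → L), (∀ j, N.p (g j)) → ∀ n, N.p (∑ j ∈ Finset.range n, g j) := by
    intro g hg n
    induction n with
    | zero => exact N.zero
    | succ n ih => rw [Finset.sum_range_succ]; exact N.add _ _ ih (hg n)
  exact N.add _ _ (N.add _ _ (ha n) (this _ (fun j => N.mul _ _ (ha _) (hb _)) n)) (hb n)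

theorem Clan.seqAdd_assoc (N : Clan L) {a b c : ℕ → L} (ga : IsGood a) (gb : IsGood b)
    (gc : IsGood c) (ha : ∀ i, N.p (a i)) (hb : ∀ i, N.p (b i)) (hc : ∀ i, N.p (c i)) :
    seqAdd (seqAdd a b) c = seqAdd a (seqAdd b c) := by
  have hL := N.chain
  revert ha
  refine good_induction hL (P := fun a => (∀ i, N.p (a i)) →
    seqAdd (seqAdd a b) c = seqAdd a (seqAdd b c)) ?_ ?_ ga
  · intro x hx
    have hx : N.p x := hx 0
    revert hb
    refine good_induction hL (P := fun b => (∀ i, N.p (b i)) →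
      seqAdd (seqAdd (single x) b) c = seqAdd (single x) (seqAdd b c)) ?_ ?_ gb
    · intro y hy
      have hy : N.p y := hy 0
      revert hc
      refine good_induction hL (P := fun c => (∀ i, N.p (c i)) →
        seqAdd (seqAdd (single x) (single y)) c =
          seqAdd (single x) (seqAdd (single y) c)) ?_ ?_ gc
      · intro z hz
        have hz : N.p z := hz 0
        rw [seqAdd_comm _ (single z), seqAdd_single, seqAdd_single, seqAdd_single, seqAdd_single]
        funext n
        match n with
        | 0 =>
          simp only [cons, single]
          abel
        | 1 =>
          simp only [cons, single, add_zero]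
          have := N.exchange y x z hy hx hz
          rw [add_comm, mul_comm z, mul_comm x y, add_comm x y, this, add_comm, mul_comm x,
            add_comm y z, add_comm z y, mul_comm y z]
        | 2 => simp only [cons, single, add_zero, mul_zero', mul_comm, mul_left_comm]
        | n + 3 => simp only [cons, single, add_zero, mul_zero']
      · intro c gc ih hc
        rw [seqAdd_cons_one_right _ (isGood_add (isGood_single x) (isGood_single y)),
          seqAdd_cons_one_right _ (isGood_single y), seqAdd_cons_one_right _ (isGood_single x),
          ih fun i => hc (i + 1)]
    · intro b gb ih hb
      rw [seqAdd_cons_one_right _ (isGood_single x), seqAdd_cons_one _ gc,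
        seqAdd_cons_one _ gc, seqAdd_cons_one_right _ (isGood_single x), ih fun i => hb (i + 1)]
  · intro a _ ih ha
    rw [seqAdd_cons_one _ gb, seqAdd_cons_one _ gc, seqAdd_cons_one _ (isGood_add gb gc),
      ih fun i => ha (i + 1)]

theorem seqAdd_cancel (hL : IsChain L) {a b c : ℕ → L} (ga : IsGood a) (gb : IsGood b)
    (gc : IsGood c) (ha : ∀ i, neg (neg (a i)) = a i) (hb : ∀ i, neg (neg (b i)) = b i)
    (hc : ∀ i, neg (neg (c i)) = c i) (h : seqAdd a c = seqAdd b c) : a = b := by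
  revert hc h
  refine good_induction hL (P := fun c => (∀ i, neg (neg (c i)) = c i) →
    seqAdd a c = seqAdd b c → a = b) ?_ ?_ gc
  · intro r hr
    have hr : neg (neg r) = r := hr 0
    have key : ∀ {b : ℕ → L}, IsGood b → (∀ i, neg (neg (b i)) = b i) → ∀ x : L,
        neg (neg x) = x → seqAdd (single x) (single r) = seqAdd b (single r) → single x = b := by
      intro b gb
      refine good_induction hL (P := fun b => (∀ i, neg (neg (b i)) = b i) → ∀ x : L,
        neg (neg x) = x → seqAdd (single x) (single r) = seqAdd b (single r) → single x = b)
        ?_ ?_ gb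
      · intro y hy x hx h
        have hy : neg (neg y) = y := hy 0
        rw [seqAdd_single, seqAdd_single] at h
        have h1 := congrFun h 0
        have h2 := congrFun h 1
        simp only [cons, single, add_zero] at h1 h2
        rw [reg_cancel hL hx hy hr h1 h2]
      · intro b _ ih hb x hx h
        rw [seqAdd_cons_one _ (isGood_single r)] at h
        have h3 := h
        rw [seqAdd_single] at h3
        have h1 := congrFun h3 0
        have h2 := congrFun h3 1
        rw [seqAdd_comm, seqAdd_single] at h2
        simp only [cons, single, add_zero] at h1 h2
        have h4 : x = 1 := eq_one_of_mul_eq hx hr h1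
          (le_antisymm (mul_le_right x r) (h2 ▸ le_add_left' r (b 0)))
        rw [h4, single_one, seqAdd_cons_one _ (isGood_single r)] at h
        rw [h4, single_one, ih (fun i => hb (i + 1)) 0 (by rw [neg_zero', neg_one'])
          (cons_inj h).2]
    revert ha b
    refine good_induction hL (P := fun a => ∀ {b : ℕ → L}, IsGood b →
      (∀ i, neg (neg (a i)) = a i) → (∀ i, neg (neg (b i)) = b i) →
      seqAdd a (single r) = seqAdd b (single r) → a = b) ?_ ?_ ga
    · intro x b gb hx hb h
      exact key gb hb x (hx 0) h
    · intro a ga' ih b gb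
      refine good_induction hL (P := fun b => (∀ i, neg (neg (cons 1 a i)) = cons 1 a i) →
        (∀ i, neg (neg (b i)) = b i) →
        seqAdd (cons 1 a) (single r) = seqAdd b (single r) → cons 1 a = b) ?_ ?_ gb
      · intro y ha hy h
        exact (key (isGood_cons_one ga') ha y (hy 0) h.symm).symm
      · intro b gb _ ha hb h
        rw [seqAdd_cons_one _ (isGood_single r), seqAdd_cons_one _ (isGood_single r)] at h
        rw [ih gb (fun i => ha (i + 1)) (fun i => hb (i + 1)) (cons_inj h).2]
  · intro c gc' ih hc h
    rw [seqAdd_cons_one_right _ ga, seqAdd_cons_one_right _ gb] at h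
    exact ih (fun i => hc (i + 1)) (cons_inj h).2

theorem seqAdd_le_cancel (hL : IsChain L) {a b c : ℕ → L} (ga : IsGood a) (gb : IsGood b)
    (gc : IsGood c) (ha : ∀ i, neg (neg (a i)) = a i) (hb : ∀ i, neg (neg (b i)) = b i)
    (hc : ∀ i, neg (neg (c i)) = c i) (h : seqAdd a c ≤ seqAdd b c) : a ≤ b := by
  rcases good_total hL ga gb with h1 | h1
  · exact h1
  · exact (seqAdd_cancel hL ga gb gc ha hb hc (le_antisymm h (seqAdd_mono h1 le_rfl))).le

theorem seqAdd_single_neg_neg (hL : IsChain L) {a : ℕ → L} (ga : IsGood a) {t : L}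
    (ht : t ≠ 0) (ht2 : neg t ≠ 0) :
    seqAdd a (single t) = seqAdd (fun i => neg (neg (a i))) (single t) := by
  refine good_induction hL (P := fun a => seqAdd a (single t) =
    seqAdd (fun i => neg (neg (a i))) (single t)) ?_ ?_ ga
  · intro x
    have e : (fun i => neg (neg (single x i))) = single (neg (neg x)) := by
      funext i
      cases i with
      | zero => rfl
      | succ i => simp only [single, cons, neg_zero', neg_one']
    rw [e]
    rcases regular_or_dense hL x with hx | hx
    · rw [hx]
    · rw [hx, neg_zero', seqAdd_single, seqAdd_single]
      funext i
      match i with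
      | 0 => simp only [single, cons, add_of_dense hL hx ht, one_add']
      | 1 => simp only [single, cons, mul_of_dense hL hx ht2, one_mul]
      | i + 2 => simp only [single, cons, mul_zero']
  · intro a _ ih
    have e : (fun i => neg (neg (cons 1 a i))) = cons 1 fun i => neg (neg (a i)) := by
      funext i
      cases i with
      | zero => simp only [cons, neg_zero', neg_one']
      | succ i => rfl
    rw [e, seqAdd_cons_one _ (isGood_single t), seqAdd_cons_one _ (isGood_single t), ih]

theorem seqAdd_prod_le (hL : IsChain L) {a b : ℕ → L} (ga : IsGood a) (gb : IsGood b) (N : ℕ)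
    {k : ℕ → L} (gk : IsGood k) (hk : ∀ i, k i = 0 ∨ neg (k i) = 0) (hN : ∀ i, N ≤ i → k i = 0)
    (h : seqAdd a k ≤ seqAdd b k) :
    seqAdd a (single (∏ i ∈ Finset.range N, (k i ⊔ neg (k i)))) ≤
      seqAdd b (single (∏ i ∈ Finset.range N, (k i ⊔ neg (k i)))) := by
  have hzero : a ≤ b → seqAdd a (single 1) ≤ seqAdd b (single 1) := fun h =>
    seqAdd_mono h le_rfl
  induction N generalizing k with
  | zero =>
    have e : k = fun _ => 0 := funext fun i => hN i (Nat.zero_le i)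
    rw [e, seqAdd_zero, seqAdd_zero] at h
    rw [Finset.prod_range_zero]
    exact hzero h
  | succ N ih =>
    rw [Finset.prod_range_succ']
    rcases eq_one_or_eq_zero hL (gk.add_succ 0) with h1 | h1
    · have e : k = cons 1 fun i => k (i + 1) := by
        funext i
        cases i with
        | zero => exact h1
        | succ i => rfl
      have g : IsGood fun i => k (i + 1) :=
        ⟨fun i => gk.add_succ (i + 1), N, fun r hr => hN (r + 1) (by omega)⟩
      rw [h1, sup_of_le_left (le_one _), mul_one]
      rw [e, seqAdd_cons_one_right _ ga, seqAdd_cons_one_right _ gb] at h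
      exact ih g (fun i => hk (i + 1)) (fun i hi => hN (i + 1) (by omega)) fun i => h (i + 1)
    · have h0 : ∀ i, k (i + 1) = 0 := by
        intro i
        induction i with
        | zero => exact h1
        | succ i ihi =>
          have := gk.add_succ (i + 1)
          rwa [ihi, zero_add] at this
      have e : k = single (k 0) := by
        funext i
        cases i with
        | zero => rfl
        | succ i => exact h0 i
      rw [Finset.prod_eq_one, one_mul]
      · rcases hk 0 with h2 | h2
        · rw [h2, neg_zero', sup_of_le_right (zero_le 1)]
          rw [e, h2, single_zero, seqAdd_zero, seqAdd_zero] at h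
          exact hzero h
        · rw [h2, sup_of_le_left (zero_le _), ← e]
          exact h
      · intro i _
        rw [h0, neg_zero', sup_of_le_right (zero_le 1)]

/-! ### Comparison of good sequences up to a common summand -/

/-- In every chain, an image of `e` is `0` or is not dense. -/
def Small (e : L) : Prop :=
  ∀ (C : Type u) [BLAlgebra C] (f : Hom L C), IsChain C → f.toFun e ≠ 0 → neg (f.toFun e) ≠ 0

/-- In every chain in which `e` vanishes, all terms of `a` are `0` or dense. -/
def Ctrl (e : L) (a : ℕ → L) : Prop :=
  ∀ (C : Type u) [BLAlgebra C] (f : Hom L C), IsChain C → f.toFun e = 0 →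
    ∀ i, f.toFun (a i) = 0 ∨ neg (f.toFun (a i)) = 0

theorem Hom.map_neg {C : Type u} [BLAlgebra C] (f : Hom L C) (x : L) :
    f.toFun (neg x) = neg (f.toFun x) := by rw [neg, f.map_imp, f.map_zero]; rfl

theorem Hom.mono {C : Type u} [BLAlgebra C] (f : Hom L C) {x y : L} (h : x ≤ y) :
    f.toFun x ≤ f.toFun y := by
  rw [le_def, ← f.map_imp, le_def.1 h, f.map_one]

theorem sup_eq_zero {x y : L} (h : x ⊔ y = 0) : x = 0 ∧ y = 0 :=
  ⟨le_zero.1 (h ▸ le_sup_left), le_zero.1 (h ▸ le_sup_right)⟩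

theorem Small.sup {e d : L} (he : Small e) (hd : Small d) : Small (e ⊔ d) := by
  intro C _ f hC h
  rw [f.map_sup] at h ⊢
  rcases hC (f.toFun e) (f.toFun d) with h1 | h1
  · rw [sup_of_le_right h1] at h ⊢; exact hd C f hC h
  · rw [sup_of_le_left h1] at h ⊢; exact he C f hC h

theorem small_zero : Small (0 : L) := fun _ _ f _ h => absurd f.map_zero h

theorem small_inf_neg (x : L) : Small (x ⊓ neg x) := by
  intro C _ f hC h h2
  rw [f.map_inf, f.map_neg] at h h2
  have h3 : neg (f.toFun x) = 0 := le_zero.1 (h2 ▸ neg_anti inf_le_left)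
  rw [h3] at h
  exact h (le_zero.1 inf_le_right)

theorem zero_or_dense_of_inf (hL : IsChain L) {x : L} (h : x ⊓ neg x = 0) :
    x = 0 ∨ neg x = 0 := by
  rcases hL x (neg x) with h1 | h1
  · left; rwa [inf_of_le_left h1] at h
  · right; rwa [inf_of_le_right h1] at h

theorem exists_ctrl {a : ℕ → L} (ha : IsGood a) : ∃ e : L, Small e ∧ Ctrl e a := by
  obtain ⟨n, hn⟩ := ha.eventually_zero
  have : ∀ m : ℕ, ∃ e : L, Small e ∧ ∀ i < m, a i ⊓ neg (a i) ≤ e := by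
    intro m
    induction m with
    | zero => exact ⟨0, small_zero, fun i hi => absurd hi (Nat.not_lt_zero i)⟩
    | succ m ih =>
      obtain ⟨e, he, h⟩ := ih
      refine ⟨e ⊔ (a m ⊓ neg (a m)), he.sup (small_inf_neg _), fun i hi => ?_⟩
      rcases Nat.lt_succ_iff_lt_or_eq.1 hi with h1 | h1
      · exact (h i h1).trans le_sup_left
      · rw [h1]; exact le_sup_right
  obtain ⟨e, he, h⟩ := this n
  refine ⟨e, he, fun C _ f hC h0 i => ?_⟩
  by_cases hi : i < n
  · apply zero_or_dense_of_inf hC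
    rw [← f.map_neg, ← f.map_inf]
    exact le_zero.1 (h0 ▸ f.mono (h i hi))
  · left; rw [hn i (by omega), f.map_zero]

theorem exists_ctrl_list (l : List (GoodSeq L)) : ∃ e : L, Small e ∧ ∀ a ∈ l, Ctrl e a.1 := by
  induction l with
  | nil => exact ⟨0, small_zero, fun a ha => by simp at ha⟩
  | cons a l ih =>
    obtain ⟨e, he, h⟩ := ih
    obtain ⟨d, hd, h2⟩ := exists_ctrl a.2
    refine ⟨e ⊔ d, he.sup hd, fun b hb C _ f hC h0 => ?_⟩
    rw [f.map_sup] at h0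
    obtain ⟨h3, h4⟩ := sup_eq_zero h0
    rcases List.mem_cons.1 hb with rfl | hb
    · exact h2 C f hC h4
    · exact h b hb C f hC h3

/-- The good sequences which are controlled by `e`. -/
def Ctrled (e : L) : Type u := {a : GoodSeq L // Ctrl e a.1}

namespace Ctrled

variable {e : L}

instance : Add (Ctrled e) where
  add a b := ⟨a.1 + b.1, fun C _ f hC h0 i => by
    have h := (denseClan hC).seqAdd_mem (a.2 C f hC h0) (b.2 C f hC h0) i
    rw [← f.map_seqAdd] at h
    exact h⟩

instance : Max (Ctrled e) where
  max a b := ⟨a.1 ⊔ b.1, fun C _ f hC h0 i => by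
    have e1 : f.toFun ((a.1 ⊔ b.1).1 i) = f.toFun (a.1.1 i) ⊔ f.toFun (b.1.1 i) := f.map_sup _ _
    rw [e1]
    rcases hC (f.toFun (a.1.1 i)) (f.toFun (b.1.1 i)) with h | h
    · rw [sup_of_le_right h]; exact b.2 C f hC h0 i
    · rw [sup_of_le_left h]; exact a.2 C f hC h0 i⟩

instance : Min (Ctrled e) where
  min a b := ⟨a.1 ⊓ b.1, fun C _ f hC h0 i => by
    have e1 : f.toFun ((a.1 ⊓ b.1).1 i) = f.toFun (a.1.1 i) ⊓ f.toFun (b.1.1 i) := f.map_inf _ _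
    rw [e1]
    rcases hC (f.toFun (a.1.1 i)) (f.toFun (b.1.1 i)) with h | h
    · rw [inf_of_le_left h]; exact a.2 C f hC h0 i
    · rw [inf_of_le_right h]; exact b.2 C f hC h0 i⟩

end Ctrled

/-- A map of `L` to a chain that respects the operations which enter into the addition of
sequences, and sends the terms of the controlled sequences to a set on which this addition is
associative. -/
structure Point (e : L) where
  C : Type u
  [inst : BLAlgebra C]
  N : Clan C
  h : L → C
  map_zero : h 0 = 0
  map_add : ∀ x y, h (x + y) = h x + h y
  map_mul : ∀ x y, h (x * y) = h x * h y
  map_sup : ∀ x y, h (x ⊔ y) = h x ⊔ h y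
  map_inf : ∀ x y, h (x ⊓ y) = h x ⊓ h y
  ctrl : ∀ a : Ctrled e, ∀ i, N.p (h (a.1.1 i))

attribute [instance] Point.inst

namespace Point

variable {e : L} (π : Point e)

theorem map_seqAdd (a b : ℕ → L) (n : ℕ) :
    π.h (seqAdd a b n) = seqAdd (fun i => π.h (a i)) (fun i => π.h (b i)) n := by
  have hsum : ∀ (g : ℕ → L) n, π.h (∑ j ∈ Finset.range n, g j) =
      ∑ j ∈ Finset.range n, π.h (g j) := by
    intro g n
    induction n with
    | zero => exact π.map_zero
    | succ n ih => rw [Finset.sum_range_succ, Finset.sum_range_succ, π.map_add, ih]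
  simp only [seqAdd, π.map_add, hsum, π.map_mul]

theorem map_isGood {a : ℕ → L} (ha : IsGood a) : IsGood fun i => π.h (a i) where
  add_succ i := by rw [← π.map_add, ha.add_succ]
  eventually_zero := by
    obtain ⟨n, hn⟩ := ha.eventually_zero
    exact ⟨n, fun r hr => by rw [hn r hr, π.map_zero]⟩

/-- The good sequences with all terms in the distinguished set of the chain. -/
def W : Type u := {a : ℕ → π.C // IsGood a ∧ ∀ i, π.N.p (a i)}

instance : PartialOrder π.W := Subtype.partialOrder _

instance : Add π.W where
  add a b := ⟨seqAdd a.1 b.1, isGood_add a.2.1 b.2.1, π.N.seqAdd_mem a.2.2 b.2.2⟩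

instance : Zero π.W where
  zero := ⟨fun _ => 0, ⟨fun _ => add_zero 0, 0, fun _ _ => rfl⟩, fun _ => π.N.zero⟩

instance : AddCommMonoid π.W where
  add_assoc a b c :=
    Subtype.ext (π.N.seqAdd_assoc a.2.1 b.2.1 c.2.1 a.2.2 b.2.2 c.2.2)
  add_comm a b := Subtype.ext (seqAdd_comm a.1 b.1)
  add_zero a := Subtype.ext (seqAdd_zero a.1)
  zero_add a := Subtype.ext ((seqAdd_comm _ _).trans (seqAdd_zero a.1))
  nsmul := nsmulRec

instance : IsOrderedAddMonoid π.W where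
  add_le_add_left a b h c := seqAdd_mono (show a.1 ≤ b.1 from h) (le_refl c.1)

/-- The image of a controlled good sequence. -/
def ev (a : Ctrled e) : π.W := ⟨fun i => π.h (a.1.1 i), π.map_isGood a.1.2, π.ctrl a⟩

theorem ev_add (a b : Ctrled e) : π.ev (a + b) = π.ev a + π.ev b :=
  Subtype.ext (funext fun n => π.map_seqAdd a.1.1 b.1.1 n)

theorem mono {x y : L} (h : x ≤ y) : π.h x ≤ π.h y := by
  rw [← sup_of_le_right h, π.map_sup]; exact le_sup_left

theorem ev_mono {a b : Ctrled e} (h : a.1 ≤ b.1) : π.ev a ≤ π.ev b :=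
  fun i => π.mono (h i)

theorem ev_total (a b : Ctrled e) : π.ev a ≤ π.ev b ∨ π.ev b ≤ π.ev a :=
  good_total π.N.chain (π.ev a).2.1 (π.ev b).2.1

theorem ev_sup (a b : Ctrled e) : π.ev (a ⊔ b) = π.ev a ∨ π.ev (a ⊔ b) = π.ev b := by
  have e1 : ∀ i, (π.ev (a ⊔ b)).1 i = (π.ev a).1 i ⊔ (π.ev b).1 i := fun i => π.map_sup _ _
  rcases π.ev_total a b with h | h
  · right; exact Subtype.ext (funext fun i => by rw [e1, sup_of_le_right (h i)])
  · left; exact Subtype.ext (funext fun i => by rw [e1, sup_of_le_left (h i)])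

theorem ev_inf (a b : Ctrled e) : π.ev (a ⊓ b) = π.ev a ∨ π.ev (a ⊓ b) = π.ev b := by
  have e1 : ∀ i, (π.ev (a ⊓ b)).1 i = (π.ev a).1 i ⊓ (π.ev b).1 i := fun i => π.map_inf _ _
  rcases π.ev_total a b with h | h
  · left; exact Subtype.ext (funext fun i => by rw [e1, inf_of_le_left (h i)])
  · right; exact Subtype.ext (funext fun i => by rw [e1, inf_of_le_right (h i)])

/-- The point given by a chain in which `e` vanishes. -/
def dense {C : Type u} [BLAlgebra C] (f : Hom L C) (hC : IsChain C) (h0 : f.toFun e = 0) :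
    Point e where
  C := C
  N := denseClan hC
  h := f.toFun
  map_zero := f.map_zero
  map_add := f.map_add
  map_mul := f.map_mul
  map_sup := f.map_sup
  map_inf := f.map_inf
  ctrl a i := a.2 C f hC h0 i

/-- The point given by the regular elements of a chain. -/
def reg (e : L) {C : Type u} [BLAlgebra C] (f : Hom L C) (hC : IsChain C) : Point e where
  C := C
  N := regClan hC
  h x := neg (neg (f.toFun x))
  map_zero := by rw [f.map_zero, neg_zero', neg_one']
  map_add x y := by rw [f.map_add, neg_neg_add hC]
  map_mul x y := by rw [f.map_mul, neg_neg_mul hC]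
  map_sup x y := by
    rw [f.map_sup]
    rcases hC (f.toFun x) (f.toFun y) with h | h
    · rw [sup_of_le_right h, sup_of_le_right (neg_anti (neg_anti h))]
    · rw [sup_of_le_left h, sup_of_le_left (neg_anti (neg_anti h))]
  map_inf x y := by
    rw [f.map_inf]
    rcases hC (f.toFun x) (f.toFun y) with h | h
    · rw [inf_of_le_left h, inf_of_le_left (neg_anti (neg_anti h))]
    · rw [inf_of_le_right h, inf_of_le_right (neg_anti (neg_anti h))]
  ctrl a i := neg_neg_neg _

end Point

namespace Ctrled

variable {e : L}

/-- If inequalities between sums with the common summand `k` hold at all points, then they hold in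
`M_L` with another common summand. -/
theorem exists_add_le (he : Small e) (k : Ctrled e) : ∃ m : GoodSeq L, ∀ a b : Ctrled e,
    (∀ π : Point e, π.ev a + π.ev k ≤ π.ev b + π.ev k) → a.1 + m ≤ b.1 + m := by
  obtain ⟨n, hn⟩ := k.1.2.eventually_zero
  set q : L := ∏ i ∈ Finset.range n, (k.1.1 i ⊔ neg (k.1.1 i)) with hq
  refine ⟨GoodSeq.of ((q ⊔ e) ⊓ (e ⊔ neg e)), fun a b hab => ?_⟩
  set t : L := (q ⊔ e) ⊓ (e ⊔ neg e) with ht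
  have hft : ∀ (C : Type u) [BLAlgebra C] (f : Hom L C), (fun i => f.toFun (single t i)) =
      single (f.toFun t) := by
    intro C _ f
    funext i
    cases i with
    | zero => rfl
    | succ i => exact f.map_zero
  have hfin : ∀ (C : Type u) [BLAlgebra C] (f : Hom L C), IsChain C →
      seqAdd (fun i => f.toFun (a.1.1 i)) (single (f.toFun t)) ≤
        seqAdd (fun i => f.toFun (b.1.1 i)) (single (f.toFun t)) := by
    intro C _ f hC
    have ga := f.map_isGood a.1.2
    have gb := f.map_isGood b.1.2
    have gk := f.map_isGood k.1.2
    by_cases h0 : f.toFun e = 0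
    · have hprod : ∀ (g : ℕ → L) m, f.toFun (∏ j ∈ Finset.range m, g j) =
          ∏ j ∈ Finset.range m, f.toFun (g j) := by
        intro g m
        induction m with
        | zero => exact f.map_one
        | succ m ih => rw [Finset.prod_range_succ, Finset.prod_range_succ, f.map_mul, ih]
      have hqt : f.toFun t = ∏ i ∈ Finset.range n,
          (f.toFun (k.1.1 i) ⊔ neg (f.toFun (k.1.1 i))) := by
        rw [ht, f.map_inf, f.map_sup, f.map_sup, f.map_neg, h0, neg_zero',
          sup_of_le_right (zero_le (1 : C)), sup_of_le_left (zero_le (f.toFun q)), inf_of_le_left (le_one _),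
          hq, hprod]
        simp only [f.map_sup, f.map_neg]
      rw [hqt]
      exact seqAdd_prod_le hC ga gb n gk (k.2 C f hC h0)
        (fun i hi => by rw [hn i hi, f.map_zero]) (hab (Point.dense f hC h0))
    · have h1 : neg (f.toFun e) ≠ 0 := he C f hC h0
      have h2 : (fun i => neg (neg (f.toFun (a.1.1 i)))) ≤
          fun i => neg (neg (f.toFun (b.1.1 i))) := by
        let π := Point.reg e f hC
        exact seqAdd_le_cancel hC (π.ev a).2.1 (π.ev b).2.1 (π.ev k).2.1
          (π.ev a).2.2 (π.ev b).2.2 (π.ev k).2.2 (hab π)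
      have h3 : f.toFun t ≠ 0 := by
        intro h
        have : f.toFun e ≤ f.toFun t := f.mono (le_inf le_sup_right le_sup_left)
        rw [h, le_zero] at this
        exact h0 this
      have h4 : neg (f.toFun t) ≠ 0 := by
        intro h
        have h5 : f.toFun t ≤ f.toFun e ⊔ neg (f.toFun e) := by
          rw [← f.map_neg, ← f.map_sup]; exact f.mono inf_le_right
        rcases hC (f.toFun e) (neg (f.toFun e)) with h6 | h6
        · rw [sup_of_le_right h6] at h5
          have h7 := neg_anti h5
          rw [h, le_zero] at h7
          exact h0 (le_zero.1 (h7 ▸ le_neg_neg _))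
        · rw [sup_of_le_left h6] at h5
          have h7 := neg_anti h5
          rw [h, le_zero] at h7
          exact h1 h7
      rw [seqAdd_single_neg_neg hC ga h3 h4, seqAdd_single_neg_neg hC gb h3 h4]
      exact seqAdd_mono h2 le_rfl
  intro i
  refine le_of_chains fun C _ f hC => ?_
  have ea : f.toFun ((a.1 + GoodSeq.of t).1 i) =
      seqAdd (fun i => f.toFun (a.1.1 i)) (single (f.toFun t)) i := by
    rw [← hft]; exact f.map_seqAdd _ _ i
  have eb : f.toFun ((b.1 + GoodSeq.of t).1 i) =
      seqAdd (fun i => f.toFun (b.1.1 i)) (single (f.toFun t)) i := by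
    rw [← hft]; exact f.map_seqAdd _ _ i
  show f.toFun ((a.1 + GoodSeq.of t).1 i) ≤ f.toFun ((b.1 + GoodSeq.of t).1 i)
  rw [ea, eb]
  exact hfin C f hC i

end Ctrled

/-! ### The Chang group -/

variable (L) in
/-- Pairs `(𝐚, 𝐛)` of good sequences. -/
abbrev Pair : Type u := GoodSeq L × GoodSeq L

/-- The relation `(𝐚, 𝐛) ∼ (𝐜, 𝐝)` on pairs of good sequences: `(𝐚 + 𝐝) + 𝐤 = (𝐛 + 𝐜) + 𝐤` for some
good sequence `𝐤`. -/
def PairEquiv (x y : Pair L) : Prop :=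
  ∃ k : GoodSeq L, x.1 + y.2 + k = x.2 + y.1 + k

/-- The relation `[𝐚, 𝐛] ≼ [𝐜, 𝐝]` on pairs of good sequences: `(𝐚 + 𝐝) + 𝐤 ≤ (𝐛 + 𝐜) + 𝐤` for some
good sequence `𝐤`. -/
def PairLE (x y : Pair L) : Prop :=
  ∃ k : GoodSeq L, x.1 + y.2 + k ≤ x.2 + y.1 + k

theorem exists_eq_val {e : L} {a : GoodSeq L} (h : Ctrl e a.1) : ∃ b : Ctrled e, b.1 = a :=
  ⟨⟨a, h⟩, rfl⟩

theorem pairLE_iff (x y : Pair L) :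
    PairEquiv x y ↔ PairLE x y ∧ PairLE y x := by
  obtain ⟨a, b⟩ := x
  obtain ⟨c, d⟩ := y
  constructor
  · rintro ⟨k, hk⟩
    refine ⟨⟨k, hk.le⟩, k, ?_⟩
    have : c + b + k = d + a + k := by
      rw [GoodSeq.add_comm c, GoodSeq.add_comm d]; exact hk.symm
    exact this.le
  · rintro ⟨⟨k, hk⟩, l, hl⟩
    obtain ⟨e, he, h⟩ := exists_ctrl_list [a, b, c, d, k, l]
    simp only [List.forall_mem_cons] at h
    obtain ⟨ha, hb, hc, hd, hk2, hl2, -⟩ := h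
    obtain ⟨a, rfl⟩ := exists_eq_val ha
    obtain ⟨b, rfl⟩ := exists_eq_val hb
    obtain ⟨c, rfl⟩ := exists_eq_val hc
    obtain ⟨d, rfl⟩ := exists_eq_val hd
    obtain ⟨k, rfl⟩ := exists_eq_val hk2
    obtain ⟨l, rfl⟩ := exists_eq_val hl2
    obtain ⟨m, hm⟩ := Ctrled.exists_add_le he (k + l)
    refine ⟨m, le_antisymm (hm (a + d) (b + c) fun π => ?_) (hm (b + c) (a + d) fun π => ?_)⟩
    · have h1 := π.ev_mono (a := a + d + k) (b := b + c + k) hk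
      simp only [Point.ev_add] at h1 ⊢
      calc _ = π.ev a + π.ev d + π.ev k + π.ev l := by abel
        _ ≤ π.ev b + π.ev c + π.ev k + π.ev l := add_le_add_left h1 _
        _ = _ := by abel
    · have h1 := π.ev_mono (a := c + b + l) (b := d + a + l) hl
      simp only [Point.ev_add] at h1 ⊢
      calc _ = π.ev c + π.ev b + π.ev l + π.ev k := by abel
        _ ≤ π.ev d + π.ev a + π.ev l + π.ev k := add_le_add_left h1 _
        _ = _ := by abel

theorem PairLE.refl (x : Pair L) : PairLE x x :=
  ⟨0, by rw [GoodSeq.add_comm x.1 x.2]⟩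

theorem PairLE.trans {x y z : Pair L} (h : PairLE x y) (h2 : PairLE y z) : PairLE x z := by
  obtain ⟨a, b⟩ := x
  obtain ⟨c, d⟩ := y
  obtain ⟨p, q⟩ := z
  obtain ⟨k, hk⟩ := h
  obtain ⟨l, hl⟩ := h2
  obtain ⟨e, he, h⟩ := exists_ctrl_list [a, b, c, d, p, q, k, l]
  simp only [List.forall_mem_cons] at h
  obtain ⟨ha, hb, hc, hd, hp, hq, hk2, hl2, -⟩ := h
  obtain ⟨a, rfl⟩ := exists_eq_val ha
  obtain ⟨b, rfl⟩ := exists_eq_val hb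
  obtain ⟨c, rfl⟩ := exists_eq_val hc
  obtain ⟨d, rfl⟩ := exists_eq_val hd
  obtain ⟨p, rfl⟩ := exists_eq_val hp
  obtain ⟨q, rfl⟩ := exists_eq_val hq
  obtain ⟨k, rfl⟩ := exists_eq_val hk2
  obtain ⟨l, rfl⟩ := exists_eq_val hl2
  obtain ⟨m, hm⟩ := Ctrled.exists_add_le he (k + l + (c + d))
  refine ⟨m, hm (a + q) (b + p) fun π => ?_⟩
  have h1 := π.ev_mono (a := a + d + k) (b := b + c + k) hk
  have h2 := π.ev_mono (a := c + q + l) (b := d + p + l) hl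
  simp only [Point.ev_add] at h1 h2 ⊢
  calc _ = (π.ev a + π.ev d + π.ev k) + (π.ev c + π.ev q + π.ev l) := by abel
    _ ≤ (π.ev b + π.ev c + π.ev k) + (π.ev d + π.ev p + π.ev l) := add_le_add h1 h2
    _ = _ := by abel

theorem PairLE.add {x y z w : Pair L} (h : PairLE x y) (h2 : PairLE z w) :
    PairLE (x.1 + z.1, x.2 + z.2) (y.1 + w.1, y.2 + w.2) := by
  obtain ⟨a, b⟩ := x
  obtain ⟨c, d⟩ := y
  obtain ⟨p, q⟩ := z
  obtain ⟨r, s⟩ := w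
  obtain ⟨k, hk⟩ := h
  obtain ⟨l, hl⟩ := h2
  obtain ⟨e, he, h⟩ := exists_ctrl_list [a, b, c, d, p, q, r, s, k, l]
  simp only [List.forall_mem_cons] at h
  obtain ⟨ha, hb, hc, hd, hp, hq, hr, hs, hk2, hl2, -⟩ := h
  obtain ⟨a, rfl⟩ := exists_eq_val ha
  obtain ⟨b, rfl⟩ := exists_eq_val hb
  obtain ⟨c, rfl⟩ := exists_eq_val hc
  obtain ⟨d, rfl⟩ := exists_eq_val hd
  obtain ⟨p, rfl⟩ := exists_eq_val hp
  obtain ⟨q, rfl⟩ := exists_eq_val hq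
  obtain ⟨r, rfl⟩ := exists_eq_val hr
  obtain ⟨s, rfl⟩ := exists_eq_val hs
  obtain ⟨k, rfl⟩ := exists_eq_val hk2
  obtain ⟨l, rfl⟩ := exists_eq_val hl2
  obtain ⟨m, hm⟩ := Ctrled.exists_add_le he (k + l)
  refine ⟨m, hm ((a + p) + (d + s)) ((b + q) + (c + r)) fun π => ?_⟩
  have h1 := π.ev_mono (a := a + d + k) (b := b + c + k) hk
  have h2 := π.ev_mono (a := p + s + l) (b := q + r + l) hl
  simp only [Point.ev_add] at h1 h2 ⊢
  calc _ = (π.ev a + π.ev d + π.ev k) + (π.ev p + π.ev s + π.ev l) := by abel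
    _ ≤ (π.ev b + π.ev c + π.ev k) + (π.ev q + π.ev r + π.ev l) := add_le_add h1 h2
    _ = _ := by abel

theorem PairLE.of_assoc (x y z : Pair L) :
    PairLE (x.1 + y.1 + z.1, x.2 + y.2 + z.2) (x.1 + (y.1 + z.1), x.2 + (y.2 + z.2)) := by
  obtain ⟨a, b⟩ := x
  obtain ⟨c, d⟩ := y
  obtain ⟨p, q⟩ := z
  obtain ⟨e, he, h⟩ := exists_ctrl_list [a, b, c, d, p, q]
  simp only [List.forall_mem_cons] at h
  obtain ⟨ha, hb, hc, hd, hp, hq, -⟩ := h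
  obtain ⟨a, rfl⟩ := exists_eq_val ha
  obtain ⟨b, rfl⟩ := exists_eq_val hb
  obtain ⟨c, rfl⟩ := exists_eq_val hc
  obtain ⟨d, rfl⟩ := exists_eq_val hd
  obtain ⟨p, rfl⟩ := exists_eq_val hp
  obtain ⟨q, rfl⟩ := exists_eq_val hq
  obtain ⟨m, hm⟩ := Ctrled.exists_add_le he a
  refine ⟨m, hm ((a + c + p) + (b + (d + q))) ((b + d + q) + (a + (c + p))) fun π => ?_⟩
  simp only [Point.ev_add]
  exact le_of_eq (by abel)

theorem PairLE.swap {x y : Pair L} (h : PairLE x y) : PairLE y.swap x.swap := by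
  obtain ⟨k, hk⟩ := h
  refine ⟨k, ?_⟩
  show y.2 + x.1 + k ≤ y.1 + x.2 + k
  rwa [GoodSeq.add_comm y.2, GoodSeq.add_comm y.1]

/-- The pair `((𝐚 + 𝐝) ∨ (𝐛 + 𝐜), 𝐛 + 𝐝)`. -/
def pairSup (x y : Pair L) : Pair L := ((x.1 + y.2) ⊔ (x.2 + y.1), x.2 + y.2)

/-- The pair `((𝐚 + 𝐝) ∧ (𝐛 + 𝐜), 𝐛 + 𝐝)`. -/
def pairInf (x y : Pair L) : Pair L := ((x.1 + y.2) ⊓ (x.2 + y.1), x.2 + y.2)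

theorem pairSup_comm (x y : Pair L) : pairSup x y = pairSup y x := by
  rw [pairSup, pairSup, sup_comm, GoodSeq.add_comm x.2 y.1, GoodSeq.add_comm x.1 y.2,
    GoodSeq.add_comm x.2 y.2]

theorem pairInf_comm (x y : Pair L) : pairInf x y = pairInf y x := by
  rw [pairInf, pairInf, inf_comm, GoodSeq.add_comm x.2 y.1, GoodSeq.add_comm x.1 y.2,
    GoodSeq.add_comm x.2 y.2]

theorem pairLE_add_right (a b d : GoodSeq L) : PairLE (a, b) (a + d, b + d) ∧
    PairLE (a + d, b + d) (a, b) := by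
  obtain ⟨e, he, h⟩ := exists_ctrl_list [a, b, d]
  simp only [List.forall_mem_cons] at h
  obtain ⟨ha, hb, hd, -⟩ := h
  obtain ⟨a, rfl⟩ := exists_eq_val ha
  obtain ⟨b, rfl⟩ := exists_eq_val hb
  obtain ⟨d, rfl⟩ := exists_eq_val hd
  obtain ⟨m, hm⟩ := Ctrled.exists_add_le he a
  refine ⟨⟨m, hm (a + (b + d)) (b + (a + d)) fun π => ?_⟩,
    ⟨m, hm ((a + d) + b) ((b + d) + a) fun π => ?_⟩⟩ <;>
  · simp only [Point.ev_add]
    exact le_of_eq (by abel)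

theorem pairLE_of_le {a b d : GoodSeq L} (h : a ≤ b) : PairLE (a, d) (b, d) :=
  ⟨0, by
    rw [GoodSeq.add_zero, GoodSeq.add_zero, GoodSeq.add_comm d b]
    exact GoodSeq.add_le_add h le_rfl⟩

theorem le_pairSup (x y : Pair L) : PairLE x (pairSup x y) :=
  (pairLE_add_right x.1 x.2 y.2).1.trans (pairLE_of_le le_sup_left)

theorem pairInf_le (x y : Pair L) : PairLE (pairInf x y) x :=
  (pairLE_of_le inf_le_left).trans (pairLE_add_right x.1 x.2 y.2).2

theorem pairSup_le {x y z : Pair L} (h : PairLE x z) (h2 : PairLE y z) :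
    PairLE (pairSup x y) z := by
  obtain ⟨a, b⟩ := x
  obtain ⟨c, d⟩ := y
  obtain ⟨p, q⟩ := z
  obtain ⟨k, hk⟩ := h
  obtain ⟨l, hl⟩ := h2
  obtain ⟨e, he, h⟩ := exists_ctrl_list [a, b, c, d, p, q, k, l]
  simp only [List.forall_mem_cons] at h
  obtain ⟨ha, hb, hc, hd, hp, hq, hk2, hl2, -⟩ := h
  obtain ⟨a, rfl⟩ := exists_eq_val ha
  obtain ⟨b, rfl⟩ := exists_eq_val hb
  obtain ⟨c, rfl⟩ := exists_eq_val hc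
  obtain ⟨d, rfl⟩ := exists_eq_val hd
  obtain ⟨p, rfl⟩ := exists_eq_val hp
  obtain ⟨q, rfl⟩ := exists_eq_val hq
  obtain ⟨k, rfl⟩ := exists_eq_val hk2
  obtain ⟨l, rfl⟩ := exists_eq_val hl2
  obtain ⟨m, hm⟩ := Ctrled.exists_add_le he (k + l)
  refine ⟨m, hm (((a + d) ⊔ (b + c)) + q) ((b + d) + p) fun π => ?_⟩
  have h1 := π.ev_mono (a := a + q + k) (b := b + p + k) hk
  have h2 := π.ev_mono (a := c + q + l) (b := d + p + l) hl
  rw [π.ev_add (_ ⊔ _)]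
  rcases π.ev_sup (a + d) (b + c) with h3 | h3
  · rw [h3]
    simp only [Point.ev_add] at h1 ⊢
    calc _ = (π.ev a + π.ev q + π.ev k) + (π.ev d + π.ev l) := by abel
      _ ≤ (π.ev b + π.ev p + π.ev k) + (π.ev d + π.ev l) := add_le_add_left h1 _
      _ = _ := by abel
  · rw [h3]
    simp only [Point.ev_add] at h2 ⊢
    calc _ = (π.ev c + π.ev q + π.ev l) + (π.ev b + π.ev k) := by abel
      _ ≤ (π.ev d + π.ev p + π.ev l) + (π.ev b + π.ev k) := add_le_add_left h2 _
      _ = _ := by abel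

theorem le_pairInf {x y z : Pair L} (h : PairLE z x) (h2 : PairLE z y) :
    PairLE z (pairInf x y) := by
  obtain ⟨a, b⟩ := x
  obtain ⟨c, d⟩ := y
  obtain ⟨p, q⟩ := z
  obtain ⟨k, hk⟩ := h
  obtain ⟨l, hl⟩ := h2
  obtain ⟨e, he, h⟩ := exists_ctrl_list [a, b, c, d, p, q, k, l]
  simp only [List.forall_mem_cons] at h
  obtain ⟨ha, hb, hc, hd, hp, hq, hk2, hl2, -⟩ := h
  obtain ⟨a, rfl⟩ := exists_eq_val ha
  obtain ⟨b, rfl⟩ := exists_eq_val hb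
  obtain ⟨c, rfl⟩ := exists_eq_val hc
  obtain ⟨d, rfl⟩ := exists_eq_val hd
  obtain ⟨p, rfl⟩ := exists_eq_val hp
  obtain ⟨q, rfl⟩ := exists_eq_val hq
  obtain ⟨k, rfl⟩ := exists_eq_val hk2
  obtain ⟨l, rfl⟩ := exists_eq_val hl2
  obtain ⟨m, hm⟩ := Ctrled.exists_add_le he (k + l)
  refine ⟨m, hm (p + (b + d)) (q + ((a + d) ⊓ (b + c))) fun π => ?_⟩
  have h1 := π.ev_mono (a := p + b + k) (b := q + a + k) hk
  have h2 := π.ev_mono (a := p + d + l) (b := q + c + l) hl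
  rw [π.ev_add q]
  rcases π.ev_inf (a + d) (b + c) with h3 | h3
  · rw [h3]
    simp only [Point.ev_add] at h1 ⊢
    calc _ = (π.ev p + π.ev b + π.ev k) + (π.ev d + π.ev l) := by abel
      _ ≤ (π.ev q + π.ev a + π.ev k) + (π.ev d + π.ev l) := add_le_add_left h1 _
      _ = _ := by abel
  · rw [h3]
    simp only [Point.ev_add] at h2 ⊢
    calc _ = (π.ev p + π.ev d + π.ev l) + (π.ev b + π.ev k) := by abel
      _ ≤ (π.ev q + π.ev c + π.ev l) + (π.ev b + π.ev k) := add_le_add_left h2 _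
      _ = _ := by abel

variable (L) in
/-- The equivalence relation `∼` on pairs of good sequences. -/
def pairSetoid : Setoid (Pair L) where
  r := PairEquiv
  iseqv :=
    { refl := fun x => ⟨0, by rw [GoodSeq.add_comm x.1 x.2]⟩
      symm := fun {x y} h => (pairLE_iff y x).2 ((pairLE_iff x y).1 h).symm
      trans := fun {x y z} h h2 => by
        rw [pairLE_iff] at h h2 ⊢
        exact ⟨h.1.trans h2.1, h2.2.trans h.2⟩ }

variable (L) in
/-- The Chang group `G_L` of the BL-algebra `L`: the quotient of `M_L × M_L` by `∼`. -/
def ChangGroup : Type u := Quotient (pairSetoid L)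

namespace ChangGroup

/-- The class `[𝐚, 𝐛]` of the pair `(𝐚, 𝐛)`. -/
def mk (a b : GoodSeq L) : ChangGroup L := Quotient.mk (pairSetoid L) (a, b)

theorem mk_eq_mk {a b c d : GoodSeq L} :
    mk a b = mk c d ↔ ∃ k : GoodSeq L, a + d + k = b + c + k :=
  Quotient.eq (r := pairSetoid L)

/-- `[𝐚, 𝐛] + [𝐜, 𝐝] = [𝐚 + 𝐜, 𝐛 + 𝐝]`. -/
instance : Add (ChangGroup L) where
  add := Quotient.map₂ (fun x y => (x.1 + y.1, x.2 + y.2)) fun x y h z w h2 => by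
    have h := (pairLE_iff x y).1 h
    have h2 := (pairLE_iff z w).1 h2
    exact (pairLE_iff _ _).2 ⟨h.1.add h2.1, h.2.add h2.2⟩

/-- `0 = [(0), (0)]`. -/
instance : Zero (ChangGroup L) where
  zero := mk (GoodSeq.of 0) (GoodSeq.of 0)

/-- `-[𝐚, 𝐛] = [𝐛, 𝐚]`. -/
instance : Neg (ChangGroup L) where
  neg := Quotient.map Prod.swap fun x y h => by
    have h := (pairLE_iff x y).1 h
    exact (pairLE_iff _ _).2 ⟨h.2.swap, h.1.swap⟩

instance : AddCommGroup (ChangGroup L) where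
  add_assoc := by
    rintro ⟨x⟩ ⟨y⟩ ⟨z⟩
    refine Quotient.sound ((pairLE_iff _ _).2 ⟨PairLE.of_assoc x y z, ?_⟩)
    have h := (PairLE.of_assoc x.swap y.swap z.swap).swap
    exact h
  add_comm := by
    rintro ⟨x⟩ ⟨y⟩
    exact congrArg (Quotient.mk _) (Prod.ext (GoodSeq.add_comm _ _) (GoodSeq.add_comm _ _))
  zero_add := by
    rintro ⟨x⟩
    exact congrArg (Quotient.mk _) (Prod.ext (GoodSeq.zero_add _) (GoodSeq.zero_add _))
  add_zero := by
    rintro ⟨x⟩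
    exact congrArg (Quotient.mk _) (Prod.ext (GoodSeq.add_zero _) (GoodSeq.add_zero _))
  neg_add_cancel := by
    rintro ⟨x⟩
    refine mk_eq_mk.2 ⟨0, ?_⟩
    show x.2 + x.1 + GoodSeq.of 0 + 0 = x.1 + x.2 + GoodSeq.of 0 + 0
    rw [GoodSeq.add_comm x.2 x.1]
  nsmul := nsmulRec
  zsmul := zsmulRec

theorem mk_add_mk (a b c d : GoodSeq L) : mk a b + mk c d = mk (a + c) (b + d) := rfl

theorem neg_mk (a b : GoodSeq L) : -mk a b = mk b a := rfl

/-- The lattice order `≼` of the Chang group. -/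
instance : Lattice (ChangGroup L) where
  le := Quotient.lift₂ PairLE fun x y z w h h2 => by
    have h := (pairLE_iff x z).1 h
    have h2 := (pairLE_iff y w).1 h2
    exact propext ⟨fun h3 => h.2.trans (h3.trans h2.1), fun h3 => h.1.trans (h3.trans h2.2)⟩
  le_refl := by
    rintro ⟨x⟩
    exact PairLE.refl x
  le_trans := by
    rintro ⟨x⟩ ⟨y⟩ ⟨z⟩ h h2
    exact PairLE.trans (x := x) (y := y) (z := z) h h2
  le_antisymm := by
    rintro ⟨x⟩ ⟨y⟩ h h2
    exact Quotient.sound ((pairLE_iff x y).2 ⟨h, h2⟩)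
  sup := Quotient.map₂ pairSup fun x z h y w h2 => by
    have h := (pairLE_iff x z).1 h
    have h2 := (pairLE_iff y w).1 h2
    refine (pairLE_iff _ _).2 ⟨?_, ?_⟩
    · exact pairSup_le (h.1.trans (le_pairSup z w))
        (h2.1.trans (by rw [pairSup_comm]; exact le_pairSup w z))
    · exact pairSup_le (h.2.trans (le_pairSup x y))
        (h2.2.trans (by rw [pairSup_comm]; exact le_pairSup y x))
  inf := Quotient.map₂ pairInf fun x z h y w h2 => by
    have h := (pairLE_iff x z).1 h
    have h2 := (pairLE_iff y w).1 h2
    refine (pairLE_iff _ _).2 ⟨?_, ?_⟩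
    · refine le_pairInf ((pairInf_le x y).trans h.1) (PairLE.trans ?_ h2.1)
      rw [pairInf_comm]; exact pairInf_le y x
    · refine le_pairInf ((pairInf_le z w).trans h.2) (PairLE.trans ?_ h2.2)
      rw [pairInf_comm]; exact pairInf_le w z
  le_sup_left := by
    rintro ⟨x⟩ ⟨y⟩
    exact le_pairSup x y
  le_sup_right := by
    rintro ⟨x⟩ ⟨y⟩
    show PairLE y (pairSup x y)
    rw [pairSup_comm]; exact le_pairSup y x
  sup_le := by
    rintro ⟨x⟩ ⟨y⟩ ⟨z⟩ h h2
    exact pairSup_le (x := x) (y := y) (z := z) h h2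
  inf_le_left := by
    rintro ⟨x⟩ ⟨y⟩
    exact pairInf_le x y
  inf_le_right := by
    rintro ⟨x⟩ ⟨y⟩
    show PairLE (pairInf x y) y
    rw [pairInf_comm]; exact pairInf_le y x
  le_inf := by
    rintro ⟨x⟩ ⟨y⟩ ⟨z⟩ h h2
    exact le_pairInf (x := y) (y := z) (z := x) h h2

theorem mk_le_mk {a b c d : GoodSeq L} :
    mk a b ≤ mk c d ↔ ∃ k : GoodSeq L, a + d + k ≤ b + c + k := Iff.rfl

theorem mk_sup_mk (a b c d : GoodSeq L) :
    mk a b ⊔ mk c d = mk ((a + d) ⊔ (b + c)) (b + d) := rfl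

theorem mk_inf_mk (a b c d : GoodSeq L) :
    mk a b ⊓ mk c d = mk ((a + d) ⊓ (b + c)) (b + d) := rfl

/-- The order of the Chang group is translation invariant, so that it is an abelian `ℓ`-group. -/
instance : IsOrderedAddMonoid (ChangGroup L) where
  add_le_add_left := by
    rintro ⟨x⟩ ⟨y⟩ h ⟨z⟩
    exact PairLE.add (x := x) (y := y) h (PairLE.refl z)

variable (L) in
/-- The element `u_L = [(1), (0)]` of the Chang group. -/
def unit : ChangGroup L := mk (GoodSeq.of 1) (GoodSeq.of 0)

end ChangGroup

end BLAlgebra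

/-- A strong unit of an abelian `ℓ`-group: an element `u ≥ 0` such that every `x` satisfies
`x ≤ n u` for some integer `n ≥ 1`. -/
def IsStrongUnit {G : Type u} [AddCommGroup G] [Lattice G] [IsOrderedAddMonoid G] (u : G) : Prop :=
  0 ≤ u ∧ ∀ x : G, ∃ n : ℕ, 1 ≤ n ∧ x ≤ n • u

namespace BLAlgebra

variable {L : Type u} [BLAlgebra L]

/-! A good sequence has only finitely many nonzero terms, and each of them is at most `1`, the top
element of the hoop. So if `𝐚` vanishes from the index `n` on, it lies termwise below `(1, …, 1, 0,
0, …)` with `n` ones, and this sequence is the `n`-fold sum of `(1)`. In the group, `[𝐚, 𝐛] = [𝐚, 0]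
- [𝐛, 0] ≼ [𝐚, 0]`, because `[𝐛, 0]` is nonnegative; hence `[𝐚, 𝐛] ≼ n u_L`. The length of `𝐛` plays
no role.

Three facts carry this. `GoodSeq.le_ones` is the termwise bound, `ChangGroup.nsmul_unit` identifies
the class of the sequence of ones with a multiple of `u_L`, and `ChangGroup.mk_le_mk_of_le` turns a
termwise inequality into one in the group and discards `𝐛` at the same time.

The addition of good sequences need not be associative, so "`n`-fold sum of `(1)`" has to be read
with a fixed bracketing; it is computed through the shift `(1) + 𝐛 = (1, b₁, b₂, …)`. In the group,
associativity is available and the ordinary multiple `n • u_L` makes sense. All inequalities hold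
already in the set of good sequences, so no auxiliary summand has to be constructed: `𝐤 = 0` always
suffices. -/

/-- The first term of the sum is `1 + b₁ = 1`, and each later one is `(1 ⊗ bᵢ) + bᵢ₊₁`, which
collapses to `bᵢ` exactly because `b` is good. Adding `(1)` is therefore a shift, and this makes
multiples of `(1)` computable. -/
theorem seqAdd_single_one {b : ℕ → L} (hb : IsGood b) : seqAdd (single 1) b = cons 1 b := by
  -- Once the leading `1` is pulled out of the sum, what remains is the zero sequence plus `b`;
  -- commutativity brings it to the form of `seqAdd_zero`.
  rw [show single (1 : L) = cons 1 fun _ => 0 from rfl, seqAdd_cons_one _ hb, seqAdd_comm,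
    seqAdd_zero]

/-! ### Sums of copies of `(1)` as upper bounds for good sequences. -/

namespace GoodSeq

/-- The zero of `GoodSeq L` is `of 0`, whose underlying sequence is built by cases on the index. At
a variable index it does not reduce to `0`, hence the appeal to `single_zero`. -/
theorem zero_val (i : ℕ) : (0 : GoodSeq L).1 i = 0 := congrFun (single_zero (L := L)) i

theorem zero_le (a : GoodSeq L) : 0 ≤ a :=
  fun i => (zero_val i).trans_le (BLAlgebra.zero_le (a.1 i))

/-- Addition is monotone in both arguments and `0` is the least good sequence, so replacing `0` by
`b` in `0 + a` can only increase the sum. -/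
theorem le_add_left (a b : GoodSeq L) : a ≤ b + a := by
  simpa only [GoodSeq.zero_add] using GoodSeq.add_le_add (zero_le b) (le_refl a)

variable (L) in
/-- The good sequence `(1, …, 1, 0, 0, …)` with `n` terms `1`. -/
def ones : ℕ → GoodSeq L
  | 0 => 0
  | n + 1 => of 1 + ones n

/-- The recursion for `ones` puts the new summand `(1)` on the left, so the shift rule applies
directly. No rebracketing is needed, which matters since sums of good sequences need not be
associative. -/
theorem ones_succ_val (n : ℕ) : (ones L (n + 1)).1 = cons 1 (ones L n).1 :=
  seqAdd_single_one (ones L n).2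

/-- Each summand `(1)` shifts the sequence by one place, so the induction has to let the index vary:
place `i + 1` of a sequence of `n + 1` ones is place `i` of one with `n` ones. The terms from the
index `n` on are not needed for the upper bound. -/
theorem ones_val_of_lt {n i : ℕ} (h : i < n) : (ones L n).1 i = 1 := by
  induction n generalizing i with
  | zero => exact absurd h (Nat.not_lt_zero i)
  | succ n ih =>
    rw [ones_succ_val]
    cases i with
    | zero => rfl
    | succ i => exact ih (Nat.lt_of_succ_lt_succ h)

theorem le_ones {a : GoodSeq L} {n : ℕ} (h : ∀ r, n ≤ r → a.1 r = 0) : a ≤ ones L n := by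
  intro i
  rcases lt_or_ge i n with hi | hi
  · exact (Hoop.le_one _).trans_eq (ones_val_of_lt hi).symm
  · exact (h i hi).trans_le (BLAlgebra.zero_le _)

end GoodSeq

/-! ### Multiples of `u_L` and the strong unit property. -/

namespace ChangGroup

/-- Subtracting the nonnegative class `[b, 0]` only lowers `[a, 0]`. In terms of representatives the
claim amounts to `a ≤ b + c`, which follows from `a ≤ c ≤ b + c`. -/
theorem mk_le_mk_of_le {a b c : GoodSeq L} (h : a ≤ c) : mk a b ≤ mk c 0 := by
  -- The inequality holds between the good sequences themselves, so the common summand can be taken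
  -- to be `0`. The goal then carries three zeros: this summand on each side, and the second entry
  -- of `mk c 0`.
  refine mk_le_mk.2 ⟨0, ?_⟩
  rw [GoodSeq.add_zero, GoodSeq.add_zero, GoodSeq.add_zero]
  exact h.trans (GoodSeq.le_add_left c b)

/-- This links the multiples in the group with the recursively bracketed sums of `(1)`. The second
entries add up to `0` since each of them is `(0)`. -/
theorem nsmul_unit (n : ℕ) : n • unit L = mk (GoodSeq.ones L n) 0 := by
  induction n with
  | zero => rw [zero_nsmul]; rfl
  | succ n ih =>
    -- The primed form `u + n • u` is the one that matches the bracketing of `ones`, with the new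
    -- summand on the left. What is left afterwards holds by definition, since `0` is `of 0`.
    rw [succ_nsmul', ih, unit, mk_add_mk, GoodSeq.add_zero]
    rfl

/-- The zero of the group is by definition the class of `(of 0, of 0)`, so this is the comparison of
`(0)` with `(1)` in the first entry. -/
theorem unit_nonneg : 0 ≤ unit L := mk_le_mk_of_le (GoodSeq.zero_le _)

theorem exists_le_nsmul_unit (x : ChangGroup L) : ∃ n : ℕ, 1 ≤ n ∧ x ≤ n • unit L := by
  obtain ⟨a, b⟩ := x
  obtain ⟨n, hn⟩ := a.2.eventually_zero
  -- The bound `n` for the support of `a` may be `0`, while the multiple must be at least `1`.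
  -- Passing to `n + 1` is harmless because `a` vanishes from there on as well.
  refine ⟨n + 1, Nat.le_add_left 1 n, ?_⟩
  rw [nsmul_unit]
  exact mk_le_mk_of_le (GoodSeq.le_ones fun r hr => hn r (by omega))

end ChangGroup

end BLAlgebra

theorem proposition5p3 (L : Type u) [BLAlgebra L] :
    IsStrongUnit (BLAlgebra.ChangGroup.unit L) :=
  ⟨BLAlgebra.ChangGroup.unit_nonneg, BLAlgebra.ChangGroup.exists_le_nsmul_unit⟩
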